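/- **Setting.** Let $n\ge 0$ and let $\Omega\subseteq\mathbb R^{2n}\times\mathbb R$ be open. Let $F=(F_1,\dots,F_{2n}):\Omega\to\mathbb R^{2n}$ and $B:\Omega\to\mathbb R$ be of class $C^2$ in $(z,t)$, put $$K_{ij}(z,t)=\frac{\partial F_j}{\partial z_i}-\frac{\partial F_i}{\partial z_j},$$ and assume $\det K\neq0$ on $\Omega$ (a regular Birkhoffian system). Let $\widehat z=g(t;z,t_0)=g^t(z,t_0)$ be its phase flow, defined on an open set $W$ of triples $(z,t,t_0)$ that contains $(z,t_0,t_0)$ for all $(z,t_0)\in\Omega$ and contains, with $(z,t,t_0)$, all $(z,s,t_0)$ with $s$ between $t_0$ and $t$: on $W$, $(\widehat z,t)\in\Omega$, $g(t_0;z,t_0)=z$ and $$K(\widehat z,t)\frac{d\widehat z}{dt}-\Big(\nabla B+\frac{\partial F}{\partial t}\Big)(\widehat z,t)=0 .$$ For all $t,t_0$ let $\alpha(t,t_0):(\widehat z,z)\mapsto(\widehat w,w)=(\alpha_1(\widehat z,z,t,t_0),\alpha_2(\widehat z,z,t,t_0))$ be a $C^1$ diffeomorphism from $\{(\widehat z,z):(\widehat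 z,t)\in\Omega,\ (z,t_0)\in\Omega\}$ onto an open subset of $\mathbb R^{4n}$ (the domain is $\mathbb R^{4n}$ if $\Omega=\mathbb R^{2n}\times\mathbb R$), of class $C^1$ in $(\widehat z,z,t)$ for each $t_0$. Write its Jacobian and that of its inverse as $$\alpha_*(\widehat z,z,t,t_0)=\begin{pmatrix}A_\alpha&B_\alpha\\ C_\alpha&D_\alpha\end{pmatrix},\qquad \alpha_*^{-1}(\widehat w,w,t,t_0)=\begin{pmatrix}A^\alpha&B^\alpha\\ C^\alpha&D^\alpha\end{pmatrix},$$ and assume, at all points of its domain, $$\alpha_*^{T}\begin{pmatrix}0&I_{2n}\\-I_{2n}&0\end{pmatrix}\alpha_*=\begin{pmatrix}K(\widehat z,t)&0\\0&-K(z,t_0)\end{pmatrix}.$$ For a $2n\times2n$ matrix $N$ define $$\bar{\mathcal A}(\widehat z,z,N,t,t_0)=(A_\alpha-NC_\alpha)\,K^{-1}\Big(\nabla B+\frac{\partial F}{\partial t}\Big)(\widehat z,t)+\frac{\partial\alpha_1}{\partial t}-N\frac{\partial\alpha_2}{\partial t},$$ with $A_\alpha,C_\alpha,\partial_t\alpha_1,\partial_t\alpha_2$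 taken at $(\widehat z,z,t,t_0)$, and $$\mathcal A(\widehat w,w,N,t,t_0)=\bar{\mathcal A}(\widehat z,z,N,t,t_0)\quad\text{with}\quad(\widehat z,z)=\alpha(t,t_0)^{-1}(\widehat w,w).$$ **Theorem 4.1.** Let $(z_0,t_0)\in\Omega$ and suppose that $|C_\alpha(z_0,z_0,t_0,t_0)+D_\alpha(z_0,z_0,t_0,t_0)|\neq0$. Then there are $\delta>0$, an open neighbourhood $U$ of $z_0$, an open neighbourhood $P$ of $\alpha_2(z_0,z_0,t_0,t_0)$, a map $f(w,t,t_0)\in\mathbb R^{2n}$ of class $C^1$ in $(w,t)\in P\times(t_0-\delta,t_0+\delta)$, and a scalar function $\phi(w,t,t_0)$ of class $C^2$ in $w\in P$ for each $|t-t_0|<\delta$, such that the following holds. 1. For all $|t-t_0|<\delta$ and $w\in P$: the Jacobian $N(w,t,t_0)=f_w(w,t,t_0)$ is symmetric, $f(w,t,t_0)=\phi_w(w,t,t_0)$, the point $(\phi_w(w,t,t_0),w)$ lies in the range of $\alpha(t,t_0)$, and $\phi_w$ is differentiable in $t$ with $$\frac{\partial}{\partial t}\phi_w(w,t,t_0)=\mathcal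 A(\phi_w(w,t,t_0),w,\phi_{ww}(w,t,t_0),t,t_0).$$ 2. For all $|t-t_0|<\delta$ and $z\in U$: $\widehat z=g(t;z,t_0)$ is defined and differentiable in $z$, with Jacobian $M=g_z(t;z,t_0)$; with $\widehat w=\alpha_1(\widehat z,z,t,t_0)$ and $w=\alpha_2(\widehat z,z,t,t_0)$ we have $w\in P$ and $$\alpha_1(g(t;z,t_0),z,t,t_0)=f(\alpha_2(g(t;z,t_0),z,t,t_0),t,t_0)=\phi_w(\alpha_2(g(t;z,t_0),z,t,t_0),t,t_0);$$ the derivatives $\frac{d\widehat w}{dt}$, $\frac{dw}{dt}$ along the flow (with $z,t_0$ fixed) exist and, for every $2n\times 2n$ matrix $N'$, $\bar{\mathcal A}(\widehat z,z,N',t,t_0)=\frac{d\widehat w}{dt}-N'\frac{dw}{dt}$; and with $N=f_w(w,t,t_0)$, the blocks $A_\alpha,\dots$ at $(\widehat z,z,t,t_0)$ and $A^\alpha,\dots$ at $(\widehat w,w,t,t_0)$, we have $|C_\alpha M+D_\alpha|\ne0$, $|C^\alpha N+D^\alpha|\neq0$ and $$N=(A_\alpha M+B_\alpha)(C_\alpha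 M+D_\alpha)^{-1},\qquad M=(A^\alpha N+B^\alpha)(C^\alpha N+D^\alpha)^{-1}.$$ -/

import Mathlib

open Set Matrix

noncomputable section

namespace Birkhoff

/-- The coordinate space `ℝ²ⁿ`. Only its topology and its differentiable structure are used. -/
abbrev Phase (n : ℕ) : Type := Fin (2 * n) → ℝ

/-- The Jacobian matrix `(∂f_i/∂x_j)` of a map of `ℝ²ⁿ`. -/
def jacobian {n : ℕ} (f : Phase n → Phase n) (x : Phase n) :
    Matrix (Fin (2 * n)) (Fin (2 * n)) ℝ :=
  Matrix.of fun i j => fderiv ℝ f x (Pi.single j 1) i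

/-- The vector `(∂φ/∂x_i)` of partial derivatives of a scalar function on `ℝ²ⁿ`. -/
def grad {n : ℕ} (φ : Phase n → ℝ) (x : Phase n) : Phase n :=
  fun i => fderiv ℝ φ x (Pi.single i 1)

/-- The matrix `K(z,t)` with entries `K_ij = ∂F_j/∂z_i - ∂F_i/∂z_j`. -/
def birkhoffMatrix {n : ℕ} (F : Phase n → ℝ → Phase n) (z : Phase n) (t : ℝ) :
    Matrix (Fin (2 * n)) (Fin (2 * n)) ℝ :=
  Matrix.of fun i j =>
    jacobian (fun x => F x t) z j i - jacobian (fun x => F x t) z i j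

/-- A regular Birkhoffian system on an open region of `ℝ²ⁿ × ℝ`, given by the Birkhoffian
functions `F = (F_i)` and the Birkhoffian `B`. -/
structure System (n : ℕ) where
  region : Set (Phase n × ℝ)
  isOpen_region : IsOpen region
  F : Phase n → ℝ → Phase n
  B : Phase n → ℝ → ℝ
  contDiffOn_F : ContDiffOn ℝ 2 (fun p : Phase n × ℝ => F p.1 p.2) region
  contDiffOn_B : ContDiffOn ℝ 2 (fun p : Phase n × ℝ => B p.1 p.2) region
  regular : ∀ z t, (z, t) ∈ region → (birkhoffMatrix F z t).det ≠ 0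

namespace System

variable {n : ℕ}

/-- The structure matrix `K(z,t)` of the system. -/
def K (S : System n) (z : Phase n) (t : ℝ) : Matrix (Fin (2 * n)) (Fin (2 * n)) ℝ :=
  birkhoffMatrix S.F z t

/-- The force term `(∇B + ∂F/∂t)(z,t)`. -/
def force (S : System n) (z : Phase n) (t : ℝ) : Phase n :=
  grad (fun x => S.B x t) z + deriv (fun s => S.F z s) t

/-- `g z t t₀` is the value at time `t` of the solution of Birkhoff's equations
`K(z,t) dz/dt - ∇B(z,t) - ∂F/∂t(z,t) = 0` that starts from `z` at time `t₀`. The set `W` of the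
triples `(z, t, t₀)` at which the flow is defined is open, contains all initial data of the
region, and its time sections are intervals around the initial time. -/
structure IsPhaseFlow (S : System n) (W : Set (Phase n × ℝ × ℝ))
    (g : Phase n → ℝ → ℝ → Phase n) : Prop where
  isOpen : IsOpen W
  initial_mem : ∀ z t₀, (z, t₀) ∈ S.region → (z, t₀, t₀) ∈ W
  segment_mem : ∀ z t t₀, (z, t, t₀) ∈ W → ∀ s ∈ uIcc t₀ t, (z, s, t₀) ∈ W
  initial_eq : ∀ z t₀, (z, t₀, t₀) ∈ W → g z t₀ t₀ = z
  mem_region : ∀ z t t₀, (z, t, t₀) ∈ W → (g z t t₀, t) ∈ S.region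
  differentiableAt : ∀ z t t₀, (z, t, t₀) ∈ W → DifferentiableAt ℝ (fun s => g z s t₀) t
  equation : ∀ z t t₀, (z, t, t₀) ∈ W →
    S.K (g z t t₀) t *ᵥ deriv (fun s => g z s t₀) t - S.force (g z t t₀) t = 0

end System

section Blocks

variable {n : ℕ}

/-- The block `∂T₁/∂ẑ` of the Jacobian of a map `(ẑ, z) ↦ (T₁ ẑ z, T₂ ẑ z)` at `p`. -/
def blockA (T : Phase n × Phase n → Phase n × Phase n) (p : Phase n × Phase n) :
    Matrix (Fin (2 * n)) (Fin (2 * n)) ℝ :=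
  jacobian (fun x => (T (x, p.2)).1) p.1

/-- The block `∂T₁/∂z` of the Jacobian of a map `(ẑ, z) ↦ (T₁ ẑ z, T₂ ẑ z)` at `p`. -/
def blockB (T : Phase n × Phase n → Phase n × Phase n) (p : Phase n × Phase n) :
    Matrix (Fin (2 * n)) (Fin (2 * n)) ℝ :=
  jacobian (fun y => (T (p.1, y)).1) p.2

/-- The block `∂T₂/∂ẑ` of the Jacobian of a map `(ẑ, z) ↦ (T₁ ẑ z, T₂ ẑ z)` at `p`. -/
def blockC (T : Phase n × Phase n → Phase n × Phase n) (p : Phase n × Phase n) :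
    Matrix (Fin (2 * n)) (Fin (2 * n)) ℝ :=
  jacobian (fun x => (T (x, p.2)).2) p.1

/-- The block `∂T₂/∂z` of the Jacobian of a map `(ẑ, z) ↦ (T₁ ẑ z, T₂ ẑ z)` at `p`. -/
def blockD (T : Phase n × Phase n → Phase n × Phase n) (p : Phase n × Phase n) :
    Matrix (Fin (2 * n)) (Fin (2 * n)) ℝ :=
  jacobian (fun y => (T (p.1, y)).2) p.2

/-- The full `4n × 4n` Jacobian. -/
def blockJacobian (T : Phase n × Phase n → Phase n × Phase n) (p : Phase n × Phase n) :
    Matrix (Fin (2 * n) ⊕ Fin (2 * n)) (Fin (2 * n) ⊕ Fin (2 * n)) ℝ :=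
  Matrix.fromBlocks (blockA T p) (blockB T p) (blockC T p) (blockD T p)

/-- `J₄ₙ = (0, I; -I, 0)`. -/
def J4 (n : ℕ) : Matrix (Fin (2 * n) ⊕ Fin (2 * n)) (Fin (2 * n) ⊕ Fin (2 * n)) ℝ :=
  Matrix.fromBlocks 0 1 (-1) 0

/-- `K̃(ẑ,z,t,t₀) = diag (K(ẑ,t), -K(z,t₀))`. -/
def Ktilde (S : System n) (zhat z : Phase n) (t t₀ : ℝ) :
    Matrix (Fin (2 * n) ⊕ Fin (2 * n)) (Fin (2 * n) ⊕ Fin (2 * n)) ℝ :=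
  Matrix.fromBlocks (S.K zhat t) 0 0 (-S.K z t₀)

end Blocks

/-- A transformation `α(t,t₀) : (ẑ, z) ↦ (ŵ, w)` with two parameters. For each `t, t₀` it is a
diffeomorphism, from the set of the pairs `(ẑ, z)` with `(ẑ, t)` and `(z, t₀)` in the region onto
an open set, such that `α_*ᵀ J₄ₙ α_* = K̃`. (If the region is all of `ℝ²ⁿ × ℝ`, the domain is all
of `ℝ⁴ⁿ`.) -/
structure Transformation {n : ℕ} (S : System n) where
  toFun : ℝ → ℝ → OpenPartialHomeomorph (Phase n × Phase n) (Phase n × Phase n)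
  source_eq : ∀ t t₀, (toFun t t₀).source =
    {p : Phase n × Phase n | (p.1, t) ∈ S.region ∧ (p.2, t₀) ∈ S.region}
  contDiffOn : ∀ t₀, ContDiffOn ℝ 1
    (fun q : (Phase n × Phase n) × ℝ => toFun q.2 t₀ q.1)
    {q | (q.1.1, q.2) ∈ S.region ∧ (q.1.2, t₀) ∈ S.region}
  contDiffOn_symm : ∀ t t₀, ContDiffOn ℝ 1 (toFun t t₀).symm (toFun t t₀).target
  lagrangian : ∀ t t₀, ∀ p ∈ (toFun t t₀).source,
    (blockJacobian (toFun t t₀) p)ᵀ * J4 n * blockJacobian (toFun t t₀) p =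
      Ktilde S p.1 p.2 t t₀

namespace Transformation

variable {n : ℕ} {S : System n}

/-- The first component `ŵ = α₁(ẑ,z,t,t₀)`. -/
def fst (α : Transformation S) (zhat z : Phase n) (t t₀ : ℝ) : Phase n :=
  (α.toFun t t₀ (zhat, z)).1

/-- The second component `w = α₂(ẑ,z,t,t₀)`. -/
def snd (α : Transformation S) (zhat z : Phase n) (t t₀ : ℝ) : Phase n :=
  (α.toFun t t₀ (zhat, z)).2

/-- `∂α₁/∂ẑ` at `(ẑ,z,t,t₀)`. -/
def A (α : Transformation S) (zhat z : Phase n) (t t₀ : ℝ) :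
    Matrix (Fin (2 * n)) (Fin (2 * n)) ℝ := blockA (α.toFun t t₀) (zhat, z)

/-- `∂α₁/∂z` at `(ẑ,z,t,t₀)`. -/
def B (α : Transformation S) (zhat z : Phase n) (t t₀ : ℝ) :
    Matrix (Fin (2 * n)) (Fin (2 * n)) ℝ := blockB (α.toFun t t₀) (zhat, z)

/-- `∂α₂/∂ẑ` at `(ẑ,z,t,t₀)`. -/
def C (α : Transformation S) (zhat z : Phase n) (t t₀ : ℝ) :
    Matrix (Fin (2 * n)) (Fin (2 * n)) ℝ := blockC (α.toFun t t₀) (zhat, z)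

/-- `∂α₂/∂z` at `(ẑ,z,t,t₀)`. -/
def D (α : Transformation S) (zhat z : Phase n) (t t₀ : ℝ) :
    Matrix (Fin (2 * n)) (Fin (2 * n)) ℝ := blockD (α.toFun t t₀) (zhat, z)

/-- The block `A^α` of the Jacobian of `α(t,t₀)⁻¹` at `(ŵ,w)`. -/
def invA (α : Transformation S) (what w : Phase n) (t t₀ : ℝ) :
    Matrix (Fin (2 * n)) (Fin (2 * n)) ℝ := blockA (α.toFun t t₀).symm (what, w)

/-- The block `B^α` of the Jacobian of `α(t,t₀)⁻¹` at `(ŵ,w)`. -/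
def invB (α : Transformation S) (what w : Phase n) (t t₀ : ℝ) :
    Matrix (Fin (2 * n)) (Fin (2 * n)) ℝ := blockB (α.toFun t t₀).symm (what, w)

/-- The block `C^α` of the Jacobian of `α(t,t₀)⁻¹` at `(ŵ,w)`. -/
def invC (α : Transformation S) (what w : Phase n) (t t₀ : ℝ) :
    Matrix (Fin (2 * n)) (Fin (2 * n)) ℝ := blockC (α.toFun t t₀).symm (what, w)

/-- The block `D^α` of the Jacobian of `α(t,t₀)⁻¹` at `(ŵ,w)`. -/
def invD (α : Transformation S) (what w : Phase n) (t t₀ : ℝ) :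
    Matrix (Fin (2 * n)) (Fin (2 * n)) ℝ := blockD (α.toFun t t₀).symm (what, w)

/-- `Ā(ẑ,z,N,t,t₀) = (A_α - N C_α) K⁻¹ (∇B + ∂F/∂t) + ∂α₁/∂t - N ∂α₂/∂t`, where `A_α`, `C_α`,
`∂α₁/∂t`, `∂α₂/∂t` are taken at `(ẑ,z,t,t₀)` and `K⁻¹`, `∇B + ∂F/∂t` at `(ẑ,t)`. -/
def calAbar (α : Transformation S) (zhat z : Phase n)
    (N : Matrix (Fin (2 * n)) (Fin (2 * n)) ℝ) (t t₀ : ℝ) : Phase n :=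
  (α.A zhat z t t₀ - N * α.C zhat z t t₀) *ᵥ ((S.K zhat t)⁻¹ *ᵥ S.force zhat t)
    + deriv (fun s => α.fst zhat z s t₀) t - N *ᵥ deriv (fun s => α.snd zhat z s t₀) t

/-- `𝒜(ŵ,w,N,t,t₀) = Ā(ẑ,z,N,t,t₀)` with `(ẑ,z) = α(t,t₀)⁻¹(ŵ,w)`. -/
def calA (α : Transformation S) (what w : Phase n)
    (N : Matrix (Fin (2 * n)) (Fin (2 * n)) ℝ) (t t₀ : ℝ) : Phase n :=
  α.calAbar ((α.toFun t t₀).symm (what, w)).1 ((α.toFun t t₀).symm (what, w)).2 N t t₀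

end Transformation

end Birkhoff

end

/-!
Solved for `dz/dt`, a regular Birkhoffian system is the flow of the `C¹` vector field
`K⁻¹ (∇B + ∂F/∂t)`. Its flow is therefore jointly `C¹` in `(z, t)` near `(z₀, t₀)`, and the Jacobian
`M` of the flow solves the variational equation (`exists_contDiffAt_flow`). Differentiating
Birkhoff's equations in `z` and antisymmetrizing shows that the two-form with matrix `K` is carried
along, i.e. `Mᵀ K(ẑ,t) M = K(z,t₀)` (`System.hasDerivAt_dotProduct_K_mulVec`,
`System.IsPhaseFlow.exists_contDiffAt`). In other words, the graph of the flow is Lagrangian for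
`diag (K(ẑ,t), -K(z,t₀))`, and `α` maps it to a Lagrangian submanifold for `J₄ₙ`.

The map `(z, t) ↦ (w, t)` with `w = α₂(g(t;z,t₀), z, t, t₀)` has an invertible derivative at
`(z₀, t₀)`, where `M = 1` and `C_α M + D_α = C_α + D_α`. Inverting it and inserting the inverse into
`ŵ = α₁(g(t;z,t₀), z, t, t₀)` gives `f`; its Jacobian is `N = (A_α M + B_α)(C_α M + D_α)⁻¹`, which
is symmetric because the submanifold is Lagrangian
(`transpose_mul_eq_transpose_mul_of_lagrangian`). Over a ball `P` the Poincaré lemma then provides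
the potential `φ` (`exists_grad_eq_of_isSymm_jacobian`). The evolution equation for `f = φ_w` is
obtained by differentiating `ŵ = f(w, t)` along the flow with `z` fixed:
`∂f/∂t = dŵ/dt - N dw/dt`, and the right-hand side is `Ā` by the chain rule
(`Transformation.exists_hasDerivAt_along`).
-/

noncomputable section

namespace Birkhoff

open Filter Metric Topology

/-! ### Differentiable dependence on initial values -/

section ShortTime

variable {E : Type*} [NormedAddCommGroup E] [NormedSpace ℝ E]

/-- A Grönwall estimate on an interval so short that `L * τ ≤ 1 / 2`. It holds on both sides of the
initial time, and the supremum of `‖u‖` can be absorbed directly into the mean value inequality. -/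
theorem norm_le_of_norm_deriv_le_of_mul_le_half {u u' : ℝ → E} {t₀ τ L ε : ℝ}
    (hτ : 0 ≤ τ) (hL : 0 ≤ L) (hLτ : L * τ ≤ 1 / 2)
    (hu : ∀ t ∈ Icc (t₀ - τ) (t₀ + τ), HasDerivWithinAt u (u' t) (Icc (t₀ - τ) (t₀ + τ)) t)
    (hb : ∀ t ∈ Icc (t₀ - τ) (t₀ + τ), ‖u' t‖ ≤ L * ‖u t‖ + ε) :
    ∀ t ∈ Icc (t₀ - τ) (t₀ + τ), ‖u t‖ ≤ 2 * (‖u t₀‖ + ε * τ) := by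
  have h0 : t₀ ∈ Icc (t₀ - τ) (t₀ + τ) := ⟨by linarith, by linarith⟩
  have hc : ContinuousOn (fun t => ‖u t‖) (Icc (t₀ - τ) (t₀ + τ)) :=
    fun t ht => (hu t ht).continuousWithinAt.norm
  obtain ⟨m, hm, hmax⟩ := isCompact_Icc.exists_isMaxOn ⟨t₀, h0⟩ hc
  have hmax' : ∀ t ∈ Icc (t₀ - τ) (t₀ + τ), ‖u t‖ ≤ ‖u m‖ := fun t ht => hmax ht
  have hmv : ‖u m - u t₀‖ ≤ (L * ‖u m‖ + ε) * ‖m - t₀‖ :=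
    Convex.norm_image_sub_le_of_norm_hasDerivWithin_le hu
      (fun t ht => (hb t ht).trans (by gcongr; exact hmax' t ht)) (convex_Icc _ _) h0 hm
  have hmt : ‖m - t₀‖ ≤ τ := by
    rw [Real.norm_eq_abs, abs_le]; constructor <;> linarith [hm.1, hm.2]
  have hnn : 0 ≤ L * ‖u m‖ + ε := (norm_nonneg _).trans (hb m hm)
  have h1 : ‖u m‖ - ‖u t₀‖ ≤ (L * ‖u m‖ + ε) * τ :=
    (norm_sub_norm_le _ _).trans (hmv.trans (mul_le_mul_of_nonneg_left hmt hnn))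
  have h2 : L * τ * ‖u m‖ ≤ 1 / 2 * ‖u m‖ := mul_le_mul_of_nonneg_right hLτ (norm_nonneg _)
  intro t ht
  have := hmax' t ht
  nlinarith

/-- A curve whose velocity is bounded by `C` as long as it stays in the ball of radius `r` cannot
leave that ball before it has had the time to do so. -/
theorem mem_closedBall_of_forall_norm_deriv_le {γ γ' : ℝ → E} {z₀ : E} {a b C ρ r : ℝ}
    (hγ : ∀ t ∈ Icc a b, HasDerivWithinAt γ (γ' t) (Icc a b) t)
    (hb : ∀ t ∈ Icc a b, γ t ∈ closedBall z₀ r → ‖γ' t‖ ≤ C)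
    (hC : 0 ≤ C) (ha : γ a ∈ closedBall z₀ ρ) (hr : ρ + (C + 1) * (b - a) ≤ r) :
    ∀ t ∈ Icc a b, γ t ∈ closedBall z₀ r := by
  have hle : ∀ t ∈ Icc a b, ρ + (C + 1) * (t - a) ≤ r := fun t ht =>
    le_trans (by have := ht.2; gcongr) hr
  have key := image_norm_le_of_norm_deriv_right_lt_deriv_boundary (a := a) (b := b)
    (f := fun t => γ t - z₀) (f' := γ') (B := fun t => ρ + (C + 1) * (t - a))
    (B' := fun _ => C + 1)
    (fun t ht => ((hγ t ht).continuousWithinAt).sub continuousWithinAt_const)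
    (fun t ht => ((hγ t (Ico_subset_Icc_self ht)).mono_of_mem_nhdsWithin
      (Icc_mem_nhdsGE_of_mem ht)).sub_const z₀)
    (by simpa [dist_eq_norm] using ha)
    (fun t => by
      simpa using (((hasDerivAt_id t).sub_const a).const_mul (C + 1)).const_add ρ)
    (fun t ht heq => by
      have ht' := Ico_subset_Icc_self ht
      have : γ t ∈ closedBall z₀ r := by
        rw [mem_closedBall, dist_eq_norm, heq]; exact hle t ht'
      linarith [hb t ht' this])
  intro t ht
  rw [mem_closedBall, dist_eq_norm]
  exact (key ht).trans (hle t ht)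

/-- The two-sided version of `mem_closedBall_of_forall_norm_deriv_le`. -/
theorem mem_closedBall_of_forall_norm_deriv_le_two_sided {γ γ' : ℝ → E} {z₀ : E} {t₀ τ C ρ r : ℝ}
    (hγ : ∀ t ∈ Icc (t₀ - τ) (t₀ + τ), HasDerivAt γ (γ' t) t)
    (hb : ∀ t ∈ Icc (t₀ - τ) (t₀ + τ), γ t ∈ closedBall z₀ r → ‖γ' t‖ ≤ C)
    (hτ : 0 ≤ τ) (hC : 0 ≤ C) (h0 : γ t₀ ∈ closedBall z₀ ρ) (hr : ρ + (C + 1) * τ ≤ r) :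
    ∀ t ∈ Icc (t₀ - τ) (t₀ + τ), γ t ∈ closedBall z₀ r := by
  have hrefl : ∀ s ∈ Icc t₀ (t₀ + τ), 2 * t₀ - s ∈ Icc (t₀ - τ) (t₀ + τ) := fun s hs =>
    ⟨by linarith [hs.2], by linarith [hs.1]⟩
  have hfwd : ∀ s ∈ Icc t₀ (t₀ + τ), s ∈ Icc (t₀ - τ) (t₀ + τ) := fun s hs =>
    ⟨by linarith [hs.1], hs.2⟩
  intro t ht
  rcases le_total t₀ t with h | h
  · exact mem_closedBall_of_forall_norm_deriv_le (a := t₀) (b := t₀ + τ)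
      (fun s hs => (hγ s (hfwd s hs)).hasDerivWithinAt) (fun s hs => hb s (hfwd s hs))
      hC h0 (by simpa using hr) t ⟨h, ht.2⟩
  · have := mem_closedBall_of_forall_norm_deriv_le (a := t₀) (b := t₀ + τ)
      (γ := fun s => γ (2 * t₀ - s)) (γ' := fun s => -γ' (2 * t₀ - s))
      (fun s hs => by
        have h1 := (hγ _ (hrefl s hs)).scomp s ((hasDerivAt_id s).const_sub (2 * t₀))
        simpa [Function.comp_def] using h1.hasDerivWithinAt)
      (fun s hs hm => by simpa using hb _ (hrefl s hs) hm)
      hC (ρ := ρ) (by convert h0 using 2; ring) (by simpa using hr) (2 * t₀ - t)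
      ⟨by linarith, by linarith [ht.1]⟩
    simpa using this

end ShortTime

/-- Joint continuity from continuity in `t` and continuity in `z` that is uniform in `t`. -/
theorem continuousAt_uncurry_of_eventually_norm_sub_le {E F : Type*} [TopologicalSpace E]
    [NormedAddCommGroup F] {h : E → ℝ → F} {z : E} {t : ℝ} {T : Set ℝ} (hT : T ∈ 𝓝 t)
    (hz : ∀ ε > 0, ∀ᶠ z' in 𝓝 z, ∀ s ∈ T, ‖h z' s - h z s‖ ≤ ε)
    (ht : ContinuousAt (h z) t) : ContinuousAt (fun p : E × ℝ => h p.1 p.2) (z, t) := by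
  rw [ContinuousAt, Metric.tendsto_nhds]
  intro ε hε
  rw [nhds_prod_eq]
  filter_upwards [(hz (ε / 2) (by positivity)).prod_mk
    ((Metric.tendsto_nhds.1 ht (ε / 2) (by positivity)).and hT)] with p hp
  have h1 := hp.1 p.2 hp.2.2
  have h2 := hp.2.1
  rw [dist_eq_norm] at h2 ⊢
  calc ‖h p.1 p.2 - h z t‖ = ‖(h p.1 p.2 - h z p.2) + (h z p.2 - h z t)‖ := by abel_nf
    _ ≤ ‖h p.1 p.2 - h z p.2‖ + ‖h z p.2 - h z t‖ := norm_add_le _ _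
    _ < ε := by linarith

section Flow

variable {E : Type*} [NormedAddCommGroup E] [NormedSpace ℝ E]

/-- The derivative with respect to the first variable of a time-dependent vector field. -/
def spatialDeriv (v : E × ℝ → E) (x : E × ℝ) : E →L[ℝ] E :=
  (fderiv ℝ v x).comp (ContinuousLinearMap.inl ℝ E ℝ)

/-- The situation in which the flow `g` of `v` is studied: a box around `(z₀, t₀)` on which `v` is
`C¹` with spatial derivative bounded by `L`, so short in time that `L * δ ≤ 1 / 2` and that the
trajectories from the ball of radius `r / 2` do not leave it. -/
structure IsFlowBox (v : E × ℝ → E) (g : E → ℝ → E) (z₀ : E) (t₀ r δ L : ℝ) : Prop where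
  r_pos : 0 < r
  δ_pos : 0 < δ
  L_nonneg : 0 ≤ L
  mul_le : L * δ ≤ 1 / 2
  differentiableAt : ∀ y ∈ closedBall z₀ r, ∀ t ∈ Icc (t₀ - δ) (t₀ + δ),
    DifferentiableAt ℝ v (y, t)
  continuousOn : ContinuousOn (spatialDeriv v) (closedBall z₀ r ×ˢ Icc (t₀ - δ) (t₀ + δ))
  norm_le : ∀ y ∈ closedBall z₀ r, ∀ t ∈ Icc (t₀ - δ) (t₀ + δ), ‖spatialDeriv v (y, t)‖ ≤ L
  initial_eq : ∀ z ∈ ball z₀ (r / 2), g z t₀ = z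
  flow_mem : ∀ z ∈ ball z₀ (r / 2), ∀ t ∈ Icc (t₀ - δ) (t₀ + δ), g z t ∈ closedBall z₀ r
  hasDerivAt : ∀ z ∈ ball z₀ (r / 2), ∀ t ∈ Icc (t₀ - δ) (t₀ + δ),
    HasDerivAt (g z) (v (g z t, t)) t

/-- The assumptions on `g` are needed only near `(z₀, t₀)`: the velocity bound `C` on a compact box
makes the trajectories stay in it for a short time. -/
theorem exists_isFlowBox [ProperSpace E] {v : E × ℝ → E} {z₀ : E} {t₀ : ℝ} {g : E → ℝ → E}
    (hv : ContDiffAt ℝ 1 v (z₀, t₀)) (hinit : ∀ᶠ z in 𝓝 z₀, g z t₀ = z)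
    (hg : ∀ᶠ p : E × ℝ in 𝓝 (z₀, t₀), HasDerivAt (g p.1) (v (g p.1 p.2, p.2)) p.2) :
    ∃ r δ L, IsFlowBox v g z₀ t₀ r δ L := by
  have hv' : ∀ᶠ p in 𝓝 (z₀, t₀), ContDiffAt ℝ 1 v p := hv.eventually (by simp)
  obtain ⟨ε, hε, hball⟩ := Metric.eventually_nhds_iff_ball.1
    (((hinit.prod_inl_nhds t₀).and hg).and hv')
  have hsub : closedBall z₀ (ε / 2) ×ˢ Icc (t₀ - ε / 2) (t₀ + ε / 2) ⊆ ball (z₀, t₀) ε := by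
    rintro ⟨y, s⟩ ⟨hy, hs⟩
    rw [← Real.closedBall_eq_Icc] at hs
    rw [mem_ball, Prod.dist_eq]
    exact max_lt (lt_of_le_of_lt hy (by linarith)) (lt_of_le_of_lt hs (by linarith))
  set Q := closedBall z₀ (ε / 2) ×ˢ Icc (t₀ - ε / 2) (t₀ + ε / 2) with hQ
  have hQc : IsCompact Q := (isCompact_closedBall _ _).prod isCompact_Icc
  have hvQ : ContinuousOn v Q := fun p hp => (hball p (hsub hp)).2.continuousAt.continuousWithinAt
  have hAQ : ContinuousOn (spatialDeriv v) Q := fun p hp =>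
    (((hball p (hsub hp)).2.fderiv_right (m := 0) (by simp)).continuousAt.clm_comp
      continuousAt_const).continuousWithinAt
  obtain ⟨C, hC⟩ := hQc.exists_bound_of_continuousOn hvQ
  obtain ⟨L, hL⟩ := hQc.exists_bound_of_continuousOn hAQ
  have h0Q : (z₀, t₀) ∈ Q := by
    refine ⟨mem_closedBall_self (by positivity), ?_, ?_⟩ <;> simp only <;> linarith
  have hC0 : 0 ≤ C := (norm_nonneg _).trans (hC _ h0Q)
  have hL0 : 0 ≤ L := (norm_nonneg _).trans (hL _ h0Q)
  obtain ⟨δ, hδ, hδε, hδC, hδL⟩ : ∃ δ > 0, δ ≤ ε / 2 ∧ (C + 1) * δ ≤ ε / 4 ∧ L * δ ≤ 1 / 2 := by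
    have e1 : ∀ᶠ δ in 𝓝[>] (0 : ℝ), δ < ε / 2 := nhdsWithin_le_nhds (Iio_mem_nhds (by positivity))
    have e2 : ∀ᶠ δ in 𝓝[>] (0 : ℝ), (C + 1) * δ < ε / 4 := by
      refine nhdsWithin_le_nhds (ContinuousAt.eventually_lt (by fun_prop) (by fun_prop) ?_)
      simpa using hε
    have e3 : ∀ᶠ δ in 𝓝[>] (0 : ℝ), L * δ < 1 / 2 := by
      refine nhdsWithin_le_nhds (ContinuousAt.eventually_lt (by fun_prop) (by fun_prop) ?_)
      simp
    obtain ⟨δ, ⟨⟨h1, h2⟩, h3⟩, h4⟩ := (((e1.and e2).and e3).and self_mem_nhdsWithin).exists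
    exact ⟨δ, h4, h1.le, h2.le, h3.le⟩
  have hIcc : Icc (t₀ - δ) (t₀ + δ) ⊆ Icc (t₀ - ε / 2) (t₀ + ε / 2) :=
    Icc_subset_Icc (by linarith) (by linarith)
  have hball2 : ∀ z ∈ ball z₀ (ε / 2 / 2), ∀ t ∈ Icc (t₀ - δ) (t₀ + δ), (z, t) ∈ Q :=
    fun z hz t ht => ⟨ball_subset_closedBall (ball_subset_ball (by linarith) hz), hIcc ht⟩
  have hder : ∀ z ∈ ball z₀ (ε / 2 / 2), ∀ t ∈ Icc (t₀ - δ) (t₀ + δ),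
      HasDerivAt (g z) (v (g z t, t)) t := fun z hz t ht =>
    (hball _ (hsub (hball2 z hz t ht))).1.2
  have hin : ∀ z ∈ ball z₀ (ε / 2 / 2), g z t₀ = z := fun z hz =>
    (hball _ (hsub (hball2 z hz t₀ ⟨by linarith, by linarith⟩))).1.1
  refine ⟨ε / 2, δ, L, by positivity, hδ, hL0, hδL, fun y hy t ht => ?_, ?_,
    fun y hy t ht => hL _ ⟨hy, hIcc ht⟩, hin, fun z hz => ?_, hder⟩
  · exact (hball _ (hsub ⟨hy, hIcc ht⟩)).2.differentiableAt (by simp)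
  · exact hAQ.mono (prod_mono_right hIcc)
  · refine mem_closedBall_of_forall_norm_deriv_le_two_sided (ρ := ε / 2 / 2) (C := C)
      (hder z hz) (fun t ht hm => hC _ ⟨hm, hIcc ht⟩) hδ.le hC0 ?_ (by linarith)
    rw [hin z hz]
    exact ball_subset_closedBall hz

namespace IsFlowBox

variable {v : E × ℝ → E} {g : E → ℝ → E} {z₀ : E} {t₀ r δ L : ℝ}

theorem self_mem (h : IsFlowBox v g z₀ t₀ r δ L) : t₀ ∈ Icc (t₀ - δ) (t₀ + δ) :=
  ⟨by linarith [h.δ_pos], by linarith [h.δ_pos]⟩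

theorem hasFDerivAt_spatial (h : IsFlowBox v g z₀ t₀ r δ L) {y : E} (hy : y ∈ closedBall z₀ r)
    {t : ℝ} (ht : t ∈ Icc (t₀ - δ) (t₀ + δ)) :
    HasFDerivAt (fun x => v (x, t)) (spatialDeriv v (y, t)) y :=
  (h.differentiableAt y hy t ht).hasFDerivAt.comp y (hasFDerivAt_prodMk_left y t)

theorem norm_sub_le (h : IsFlowBox v g z₀ t₀ r δ L) {y y' : E} (hy : y ∈ closedBall z₀ r)
    (hy' : y' ∈ closedBall z₀ r) {t : ℝ} (ht : t ∈ Icc (t₀ - δ) (t₀ + δ)) :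
    ‖v (y', t) - v (y, t)‖ ≤ L * ‖y' - y‖ :=
  (convex_closedBall z₀ r).norm_image_sub_le_of_norm_hasFDerivWithin_le
    (f := fun x => v (x, t))
    (fun _ hx => (h.hasFDerivAt_spatial hx ht).hasFDerivWithinAt)
    (fun x hx => h.norm_le x hx t ht) hy hy'

/-- By uniform continuity on the compact box, the linearization of `v` in the space variable is
uniform in the base point and in time. -/
theorem exists_linearization [ProperSpace E] (h : IsFlowBox v g z₀ t₀ r δ L) {ε : ℝ}
    (hε : 0 < ε) :
    ∃ η > 0, ∀ y ∈ closedBall z₀ r, ∀ y' ∈ closedBall z₀ r, ‖y' - y‖ ≤ η →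
      ∀ t ∈ Icc (t₀ - δ) (t₀ + δ), ‖spatialDeriv v (y', t) - spatialDeriv v (y, t)‖ ≤ ε ∧
        ‖v (y', t) - v (y, t) - spatialDeriv v (y, t) (y' - y)‖ ≤ ε * ‖y' - y‖ := by
  have huc := ((isCompact_closedBall z₀ r).prod
    (isCompact_Icc (a := t₀ - δ) (b := t₀ + δ))).uniformContinuousOn_of_continuous h.continuousOn
  obtain ⟨η, hη, hη'⟩ := Metric.uniformContinuousOn_iff_le.1 huc ε hε
  have hA : ∀ y ∈ closedBall z₀ r, ∀ y' ∈ closedBall z₀ r, ‖y' - y‖ ≤ η →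
      ∀ t ∈ Icc (t₀ - δ) (t₀ + δ), ‖spatialDeriv v (y', t) - spatialDeriv v (y, t)‖ ≤ ε := by
    intro y hy y' hy' hyy t ht
    rw [← dist_eq_norm]
    refine hη' (y', t) ⟨hy', ht⟩ (y, t) ⟨hy, ht⟩ ?_
    simpa [Prod.dist_eq, dist_eq_norm, hη.le] using hyy
  refine ⟨η, hη, fun y hy y' hy' hyy t ht => ⟨hA y hy y' hy' hyy t ht, ?_⟩⟩
  have hseg : segment ℝ y y' ⊆ closedBall z₀ r := (convex_closedBall z₀ r).segment_subset hy hy'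
  refine (convex_segment y y').norm_image_sub_le_of_norm_hasFDerivWithin_le'
    (f := fun x => v (x, t))
    (fun x hx => (h.hasFDerivAt_spatial (hseg hx) ht).hasFDerivWithinAt)
    (fun x hx => hA y hy x (hseg hx) ?_ t ht) (left_mem_segment ℝ y y') (right_mem_segment ℝ y y')
  have : x ∈ closedBall y ‖y' - y‖ :=
    (convex_closedBall y _).segment_subset (mem_closedBall_self (norm_nonneg _))
      (by simp [dist_eq_norm]) hx
  rw [Metric.mem_closedBall, dist_eq_norm] at this
  exact this.trans hyy

theorem norm_flow_sub_le (h : IsFlowBox v g z₀ t₀ r δ L) {z z' : E} (hz : z ∈ ball z₀ (r / 2))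
    (hz' : z' ∈ ball z₀ (r / 2)) :
    ∀ t ∈ Icc (t₀ - δ) (t₀ + δ), ‖g z' t - g z t‖ ≤ 2 * ‖z' - z‖ := by
  intro t ht
  have := norm_le_of_norm_deriv_le_of_mul_le_half (u := fun t => g z' t - g z t) (ε := 0)
    h.δ_pos.le h.L_nonneg h.mul_le
    (fun t ht => ((h.hasDerivAt z' hz' t ht).sub (h.hasDerivAt z hz t ht)).hasDerivWithinAt)
    (fun t ht => by
      simpa using h.norm_sub_le (h.flow_mem z hz t ht) (h.flow_mem z' hz' t ht) ht)
    t ht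
  simpa [h.initial_eq z hz, h.initial_eq z' hz'] using this

/-- The variational equation along a trajectory has a solution on the whole time interval of the
box. -/
theorem exists_variational [CompleteSpace E] (h : IsFlowBox v g z₀ t₀ r δ L) {z : E}
    (hz : z ∈ ball z₀ (r / 2)) :
    ∃ M : ℝ → E →L[ℝ] E, M t₀ = ContinuousLinearMap.id ℝ E ∧
      ∀ t ∈ Icc (t₀ - δ) (t₀ + δ),
        HasDerivWithinAt M ((spatialDeriv v (g z t, t)).comp (M t)) (Icc (t₀ - δ) (t₀ + δ)) t := by
  lift L to NNReal using h.L_nonneg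
  have hPL : IsPicardLindelof (fun t (m : E →L[ℝ] E) => (spatialDeriv v (g z t, t)).comp m)
      (⟨t₀, h.self_mem⟩ : Icc (t₀ - δ) (t₀ + δ)) (ContinuousLinearMap.id ℝ E) 1 0 (2 * L) L := by
    refine ⟨fun t ht => ?_, fun m _ => ?_, fun t ht m hm => ?_, ?_⟩
    · refine LipschitzOnWith.of_dist_le_mul fun m _ m' _ => ?_
      rw [dist_eq_norm, dist_eq_norm, ← ContinuousLinearMap.comp_sub]
      exact (ContinuousLinearMap.opNorm_comp_le _ _).trans
        (mul_le_mul_of_nonneg_right (h.norm_le _ (h.flow_mem z hz t ht) t ht)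
          (norm_nonneg _))
    · have hc : ContinuousOn (fun t => spatialDeriv v (g z t, t)) (Icc (t₀ - δ) (t₀ + δ)) :=
        h.continuousOn.comp
          (fun t ht => ((h.hasDerivAt z hz t ht).continuousAt.prodMk
            continuousAt_id).continuousWithinAt)
          (fun t ht => ⟨h.flow_mem z hz t ht, ht⟩)
      exact hc.clm_comp continuousOn_const
    -- on the unit ball around the identity `‖m‖ ≤ 2`, whence the bound `2 * L` of the field
    · have hm2 : ‖m‖ ≤ 2 := by
        have h1 : ‖m - ContinuousLinearMap.id ℝ E‖ ≤ 1 := by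
          simpa [dist_eq_norm] using hm
        have h2 := norm_le_insert' m (ContinuousLinearMap.id ℝ E)
        have h3 := ContinuousLinearMap.norm_id_le (𝕜 := ℝ) (E := E)
        linarith
      refine (ContinuousLinearMap.opNorm_comp_le _ _).trans ?_
      have := mul_le_mul (h.norm_le _ (h.flow_mem z hz t ht) t ht) hm2 (norm_nonneg _)
        h.L_nonneg
      simpa [mul_comm] using this
    · have := h.mul_le
      have h2 : max (t₀ + δ - t₀) (t₀ - (t₀ - δ)) = δ := by simp
      simp only [h2]
      push_cast
      linarith
  exact hPL.exists_eq_forall_mem_Icc_hasDerivWithinAt₀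

variable {M : E → ℝ → E →L[ℝ] E}

/-- The solution of the variational equation is the derivative of the flow. -/
theorem hasFDerivAt_flow [ProperSpace E] (h : IsFlowBox v g z₀ t₀ r δ L)
    (hM0 : ∀ z ∈ ball z₀ (r / 2), M z t₀ = ContinuousLinearMap.id ℝ E)
    (hM : ∀ z ∈ ball z₀ (r / 2), ∀ t ∈ Icc (t₀ - δ) (t₀ + δ),
      HasDerivWithinAt (M z) ((spatialDeriv v (g z t, t)).comp (M z t))
        (Icc (t₀ - δ) (t₀ + δ)) t)
    {z : E} (hz : z ∈ ball z₀ (r / 2)) {t : ℝ} (ht : t ∈ Icc (t₀ - δ) (t₀ + δ)) :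
    HasFDerivAt (fun x => g x t) (M z t) z := by
  rw [hasFDerivAt_iff_isLittleO, Asymptotics.isLittleO_iff]
  intro c hc
  have hδ := h.δ_pos
  obtain ⟨η, hη, hlin⟩ := h.exists_linearization (ε := c / (4 * δ)) (by positivity)
  filter_upwards [isOpen_ball.mem_nhds hz, closedBall_mem_nhds z (half_pos hη)] with z' hz' hzz
  rw [Metric.mem_closedBall, dist_eq_norm] at hzz
  -- the error of the linearization satisfies the variational equation up to `o(‖z' - z‖)`
  have key := norm_le_of_norm_deriv_le_of_mul_le_half
    (u := fun s => g z' s - g z s - M z s (z' - z)) (ε := c / (4 * δ) * (2 * ‖z' - z‖))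
    (u' := fun s => v (g z' s, s) - v (g z s, s) - spatialDeriv v (g z s, s) (M z s (z' - z)))
    hδ.le h.L_nonneg h.mul_le
    (fun s hs => ((h.hasDerivAt z' hz' s hs).sub (h.hasDerivAt z hz s hs)).hasDerivWithinAt.sub
      ((hM z hz s hs).clm_apply (hasDerivWithinAt_const s _ (z' - z)) |>.congr_deriv (by simp)))
    (fun s hs => by
      have hy := h.flow_mem z hz s hs
      have hy' := h.flow_mem z' hz' s hs
      have hd := h.norm_flow_sub_le hz hz' s hs
      have h1 := (hlin _ hy _ hy' (hd.trans (by linarith)) s hs).2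
      have h2 : ‖spatialDeriv v (g z s, s) (g z' s - g z s - M z s (z' - z))‖
          ≤ L * ‖g z' s - g z s - M z s (z' - z)‖ :=
        (ContinuousLinearMap.le_opNorm _ _).trans
          (mul_le_mul_of_nonneg_right (h.norm_le _ hy s hs) (norm_nonneg _))
      have h3 : c / (4 * δ) * ‖g z' s - g z s‖ ≤ c / (4 * δ) * (2 * ‖z' - z‖) := by gcongr
      calc ‖v (g z' s, s) - v (g z s, s) - spatialDeriv v (g z s, s) (M z s (z' - z))‖
          = ‖spatialDeriv v (g z s, s) (g z' s - g z s - M z s (z' - z)) +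
            (v (g z' s, s) - v (g z s, s) - spatialDeriv v (g z s, s) (g z' s - g z s))‖ := by
            congr 1; simp only [map_sub]; abel
        _ ≤ _ := norm_add_le _ _
        _ ≤ _ := add_le_add h2 (h1.trans h3))
    t ht
  simp only [h.initial_eq z hz, h.initial_eq z' hz', hM0 z hz, ContinuousLinearMap.id_apply,
    sub_self, norm_zero, zero_add] at key
  refine key.trans (le_of_eq ?_)
  field_simp
  norm_num

/-- The solution of the variational equation depends continuously on the trajectory. -/
theorem eventually_norm_variational_sub_le [ProperSpace E] (h : IsFlowBox v g z₀ t₀ r δ L)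
    (hM0 : ∀ z ∈ ball z₀ (r / 2), M z t₀ = ContinuousLinearMap.id ℝ E)
    (hM : ∀ z ∈ ball z₀ (r / 2), ∀ t ∈ Icc (t₀ - δ) (t₀ + δ),
      HasDerivWithinAt (M z) ((spatialDeriv v (g z t, t)).comp (M z t))
        (Icc (t₀ - δ) (t₀ + δ)) t)
    {z : E} (hz : z ∈ ball z₀ (r / 2)) {ε : ℝ} (hε : 0 < ε) :
    ∀ᶠ z' in 𝓝 z, ∀ t ∈ Icc (t₀ - δ) (t₀ + δ), ‖M z' t - M z t‖ ≤ ε := by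
  have hδ := h.δ_pos
  obtain ⟨η, hη, hlin⟩ := h.exists_linearization (ε := ε / (4 * δ)) (by positivity)
  have hbdd : ∀ z' ∈ ball z₀ (r / 2), ∀ t ∈ Icc (t₀ - δ) (t₀ + δ), ‖M z' t‖ ≤ 2 := by
    intro z' hz' t ht
    have := norm_le_of_norm_deriv_le_of_mul_le_half (u := M z') (ε := 0)
      hδ.le h.L_nonneg h.mul_le (hM z' hz')
      (fun s hs => by
        rw [add_zero]
        exact (ContinuousLinearMap.opNorm_comp_le _ _).trans
          (mul_le_mul_of_nonneg_right (h.norm_le _ (h.flow_mem z' hz' s hs) s hs)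
            (norm_nonneg _))) t ht
    rw [hM0 z' hz'] at this
    have h3 := ContinuousLinearMap.norm_id_le (𝕜 := ℝ) (E := E)
    linarith
  filter_upwards [isOpen_ball.mem_nhds hz, closedBall_mem_nhds z (half_pos hη)] with z' hz' hzz
  rw [Metric.mem_closedBall, dist_eq_norm] at hzz
  intro t ht
  have key := norm_le_of_norm_deriv_le_of_mul_le_half
    (u := fun s => M z' s - M z s) (ε := ε / (4 * δ) * 2)
    hδ.le h.L_nonneg h.mul_le (fun s hs => (hM z' hz' s hs).sub (hM z hz s hs))
    (fun s hs => by
      have hy := h.flow_mem z hz s hs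
      have hy' := h.flow_mem z' hz' s hs
      have hd := h.norm_flow_sub_le hz hz' s hs
      have h1 := (hlin _ hy _ hy' (hd.trans (by linarith)) s hs).1
      calc ‖(spatialDeriv v (g z' s, s)).comp (M z' s) - (spatialDeriv v (g z s, s)).comp (M z s)‖
          = ‖(spatialDeriv v (g z' s, s)).comp (M z' s - M z s) +
            (spatialDeriv v (g z' s, s) - spatialDeriv v (g z s, s)).comp (M z s)‖ := by
            congr 1
            rw [ContinuousLinearMap.comp_sub, ContinuousLinearMap.sub_comp]; abel
        _ ≤ _ := norm_add_le _ _
        _ ≤ L * ‖M z' s - M z s‖ + ε / (4 * δ) * 2 := by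
            refine add_le_add ?_ ?_
            · exact (ContinuousLinearMap.opNorm_comp_le _ _).trans
                (mul_le_mul_of_nonneg_right (h.norm_le _ hy' s hs) (norm_nonneg _))
            · exact (ContinuousLinearMap.opNorm_comp_le _ _).trans
                (mul_le_mul h1 (hbdd z hz s hs) (norm_nonneg _) (by positivity)))
    t ht
  simp only [hM0 z hz, hM0 z' hz', sub_self, norm_zero, zero_add] at key
  refine key.trans (le_of_eq ?_)
  field_simp
  norm_num

end IsFlowBox

/-- **Differentiable dependence on initial values.** The flow of a time-dependent `C¹` vector field
is, locally, jointly `C¹`, and its spatial derivative solves the variational equation. -/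
theorem exists_contDiffAt_flow [ProperSpace E] {v : E × ℝ → E} {z₀ : E} {t₀ : ℝ}
    {g : E → ℝ → E} (hv : ContDiffAt ℝ 1 v (z₀, t₀)) (hinit : ∀ᶠ z in 𝓝 z₀, g z t₀ = z)
    (hg : ∀ᶠ p : E × ℝ in 𝓝 (z₀, t₀), HasDerivAt (g p.1) (v (g p.1 p.2, p.2)) p.2) :
    ∃ r > 0, ∃ δ > 0, ∃ M : E → ℝ → E →L[ℝ] E, ∀ z ∈ ball z₀ r,
      M z t₀ = ContinuousLinearMap.id ℝ E ∧ ∀ t ∈ Ioo (t₀ - δ) (t₀ + δ),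
        HasFDerivAt (fun x => g x t) (M z t) z ∧
        HasDerivAt (M z) ((spatialDeriv v (g z t, t)).comp (M z t)) t ∧
        ContDiffAt ℝ 1 (fun p : E × ℝ => g p.1 p.2) (z, t) := by
  obtain ⟨r, δ, L, h⟩ := exists_isFlowBox hv hinit hg
  have hex : ∀ z, ∃ M : ℝ → E →L[ℝ] E, z ∈ ball z₀ (r / 2) →
      M t₀ = ContinuousLinearMap.id ℝ E ∧ ∀ t ∈ Icc (t₀ - δ) (t₀ + δ),
        HasDerivWithinAt M ((spatialDeriv v (g z t, t)).comp (M t)) (Icc (t₀ - δ) (t₀ + δ)) t := by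
    intro z
    by_cases hz : z ∈ ball z₀ (r / 2)
    · obtain ⟨M, hM⟩ := h.exists_variational hz
      exact ⟨M, fun _ => hM⟩
    · exact ⟨0, fun hz' => absurd hz' hz⟩
  choose M hM' using hex
  have hM0 := fun z hz => (hM' z hz).1
  have hM := fun z hz => (hM' z hz).2
  have hfd : ∀ z ∈ ball z₀ (r / 2), ∀ t ∈ Icc (t₀ - δ) (t₀ + δ),
      HasFDerivAt (fun x => g x t) (M z t) z := fun z hz t ht => h.hasFDerivAt_flow hM0 hM hz ht
  have hMd : ∀ z ∈ ball z₀ (r / 2), ∀ t ∈ Ioo (t₀ - δ) (t₀ + δ),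
      HasDerivAt (M z) ((spatialDeriv v (g z t, t)).comp (M z t)) t := fun z hz t ht =>
    (hM z hz t (Ioo_subset_Icc_self ht)).hasDerivAt (Icc_mem_nhds ht.1 ht.2)
  have hopen : IsOpen (ball z₀ (r / 2) ×ˢ Ioo (t₀ - δ) (t₀ + δ)) := isOpen_ball.prod isOpen_Ioo
  have hMc : ∀ p ∈ ball z₀ (r / 2) ×ˢ Ioo (t₀ - δ) (t₀ + δ),
      ContinuousAt (fun p : E × ℝ => M p.1 p.2) p := fun p hp =>
    continuousAt_uncurry_of_eventually_norm_sub_le (Icc_mem_nhds hp.2.1 hp.2.2)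
      (fun ε hε => h.eventually_norm_variational_sub_le hM0 hM hp.1 hε)
      (hMd p.1 hp.1 p.2 hp.2).continuousAt
  have hgc : ∀ p ∈ ball z₀ (r / 2) ×ˢ Ioo (t₀ - δ) (t₀ + δ),
      ContinuousAt (fun p : E × ℝ => g p.1 p.2) p := by
    intro p hp
    refine continuousAt_uncurry_of_eventually_norm_sub_le (Icc_mem_nhds hp.2.1 hp.2.2)
      (fun ε hε => ?_) (h.hasDerivAt p.1 hp.1 p.2 (Ioo_subset_Icc_self hp.2)).continuousAt
    filter_upwards [isOpen_ball.mem_nhds hp.1, closedBall_mem_nhds p.1 (half_pos hε)] with z' h1 h2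
    intro s hs
    rw [Metric.mem_closedBall, dist_eq_norm] at h2
    linarith [h.norm_flow_sub_le hp.1 h1 s hs]
  have hvc : ∀ p ∈ ball z₀ (r / 2) ×ˢ Ioo (t₀ - δ) (t₀ + δ),
      ContinuousAt (fun p : E × ℝ => ContinuousLinearMap.toSpanSingleton ℝ (v (g p.1 p.2, p.2)))
        p := by
    intro p hp
    have hvp : ContinuousAt v (g p.1 p.2, p.2) := (h.differentiableAt _
      (h.flow_mem p.1 hp.1 p.2 (Ioo_subset_Icc_self hp.2)) _
      (Ioo_subset_Icc_self hp.2)).continuousAt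
    have h1 : ContinuousAt (fun p : E × ℝ => v (g p.1 p.2, p.2)) p :=
      ContinuousAt.comp (f := fun p : E × ℝ => (g p.1 p.2, p.2)) hvp
        ((hgc p hp).prodMk continuousAt_snd)
    exact ((ContinuousLinearMap.toSpanSingletonCLE (𝕜 := ℝ) (E := E)).continuous.continuousAt).comp
      h1
  refine ⟨r / 2, half_pos h.r_pos, δ, h.δ_pos, M, fun z hz => ⟨hM0 z hz, fun t ht =>
    ⟨hfd z hz t (Ioo_subset_Icc_self ht), hMd z hz t ht, ?_⟩⟩⟩
  rw [contDiffAt_one_iff]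
  refine ⟨fun p => (M p.1 p.2).coprod
    (ContinuousLinearMap.toSpanSingleton ℝ (v (g p.1 p.2, p.2))),
    _, hopen.mem_nhds ⟨hz, ht⟩, fun p hp => ?_, fun p hp => ?_⟩
  · exact ((hMc p hp).continuousLinearMapCoprod (hvc p hp)).continuousWithinAt
  · refine HasStrictFDerivAt.hasFDerivAt (hasStrictFDerivAt_uncurry_coprod (f := g)
      (f₁ := M) (f₂ := fun z t => ContinuousLinearMap.toSpanSingleton ℝ (v (g z t, t)))
      ?_ ?_ (hMc p hp) (hvc p hp))
    · filter_upwards [hopen.mem_nhds hp] with q hq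
      exact hfd q.1 hq.1 q.2 (Ioo_subset_Icc_self hq.2)
    · filter_upwards [hopen.mem_nhds hp] with q hq
      exact (h.hasDerivAt q.1 hq.1 q.2 (Ioo_subset_Icc_self hq.2)).hasFDerivAt

end Flow

/-! ### Birkhoff's equations and the invariance of the form `K` -/

section MatrixCalculus

theorem contDiffAt_det {E ι : Type*} [NormedAddCommGroup E] [NormedSpace ℝ E] [Fintype ι]
    [DecidableEq ι] {k : WithTop ℕ∞} {A : E → Matrix ι ι ℝ} {x : E}
    (hA : ∀ i j, ContDiffAt ℝ k (fun y => A y i j) x) : ContDiffAt ℝ k (fun y => (A y).det) x := by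
  simp only [Matrix.det_apply']
  exact ContDiffAt.sum fun σ _ => contDiffAt_const.mul (contDiffAt_prod fun i _ => hA _ _)

theorem contDiffAt_inv_entry {E ι : Type*} [NormedAddCommGroup E] [NormedSpace ℝ E] [Fintype ι]
    [DecidableEq ι] {k : WithTop ℕ∞} {A : E → Matrix ι ι ℝ} {x : E}
    (hA : ∀ i j, ContDiffAt ℝ k (fun y => A y i j) x) (hdet : (A x).det ≠ 0) (i j : ι) :
    ContDiffAt ℝ k (fun y => (A y)⁻¹ i j) x := by
  simp only [Matrix.inv_def, Ring.inverse_eq_inv', Matrix.smul_apply, Matrix.adjugate_apply,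
    smul_eq_mul]
  refine ((contDiffAt_det hA).inv hdet).mul (contDiffAt_det fun k l => ?_)
  by_cases hk : k = j
  · subst hk
    simpa using contDiffAt_const
  · simpa [Matrix.updateRow_apply, hk] using hA k l

theorem _root_.HasDerivAt.dotProduct {ι : Type*} [Fintype ι] {u w : ℝ → ι → ℝ} {u' w' : ι → ℝ}
    {t : ℝ} (hu : HasDerivAt u u' t) (hw : HasDerivAt w w' t) :
    HasDerivAt (fun s => u s ⬝ᵥ w s) (u' ⬝ᵥ w t + u t ⬝ᵥ w') t := by
  simp only [_root_.dotProduct, ← Finset.sum_add_distrib]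
  exact HasDerivAt.fun_sum fun i _ => (hasDerivAt_pi.1 hu i).mul (hasDerivAt_pi.1 hw i)

variable {n : ℕ}

theorem jacobian_eq_toMatrix' (f : Phase n → Phase n) (x : Phase n) :
    jacobian f x = LinearMap.toMatrix' (fderiv ℝ f x : Phase n →ₗ[ℝ] Phase n) := by
  ext i j
  simp [jacobian, LinearMap.toMatrix'_apply]

theorem jacobian_mulVec (f : Phase n → Phase n) (x v : Phase n) :
    jacobian f x *ᵥ v = fderiv ℝ f x v := by
  rw [jacobian_eq_toMatrix', LinearMap.toMatrix'_mulVec]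
  rfl

theorem grad_dotProduct (φ : Phase n → ℝ) (x v : Phase n) : grad φ x ⬝ᵥ v = fderiv ℝ φ x v := by
  have hv : v = ∑ i, v i • (Pi.single i 1 : Phase n) := by
    ext k
    simp [Finset.sum_apply, Pi.single_apply]
  conv_rhs => rw [hv]
  simp only [map_sum, map_smul, smul_eq_mul, _root_.dotProduct, grad, mul_comm]

theorem dotProduct_birkhoffMatrix_mulVec (F : Phase n → ℝ → Phase n) (z : Phase n) (t : ℝ)
    (u v : Phase n) :
    u ⬝ᵥ birkhoffMatrix F z t *ᵥ v =
      fderiv ℝ (fun x => F x t) z u ⬝ᵥ v - fderiv ℝ (fun x => F x t) z v ⬝ᵥ u := by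
  have h : birkhoffMatrix F z t
      = (jacobian (fun x => F x t) z)ᵀ - jacobian (fun x => F x t) z := by
    ext i j; simp [birkhoffMatrix]
  rw [h, Matrix.sub_mulVec, dotProduct_sub, dotProduct_mulVec, Matrix.vecMul_transpose,
    jacobian_mulVec, jacobian_mulVec, dotProduct_comm u]

end MatrixCalculus

namespace System

variable {n : ℕ} (S : System n)

/-- The functions `F` of the system as a map on `ℝ²ⁿ × ℝ`. -/
def uF (p : Phase n × ℝ) : Phase n := S.F p.1 p.2

/-- The Birkhoffian as a map on `ℝ²ⁿ × ℝ`. -/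
def uB (p : Phase n × ℝ) : ℝ := S.B p.1 p.2

/-- The vector field `K⁻¹ (∇B + ∂F/∂t)` of Birkhoff's equations solved for `dz/dt`. -/
def field (p : Phase n × ℝ) : Phase n := (S.K p.1 p.2)⁻¹ *ᵥ S.force p.1 p.2

variable {S} {p : Phase n × ℝ}

theorem contDiffAt_uF (hp : p ∈ S.region) : ContDiffAt ℝ 2 S.uF p :=
  S.contDiffOn_F.contDiffAt (S.isOpen_region.mem_nhds hp)

theorem contDiffAt_uB (hp : p ∈ S.region) : ContDiffAt ℝ 2 S.uB p :=
  S.contDiffOn_B.contDiffAt (S.isOpen_region.mem_nhds hp)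

theorem contDiffAt_fderiv_uF (hp : p ∈ S.region) : ContDiffAt ℝ 1 (fderiv ℝ S.uF) p :=
  (contDiffAt_uF hp).fderiv_right (by norm_num)

theorem contDiffAt_fderiv_uB (hp : p ∈ S.region) : ContDiffAt ℝ 1 (fderiv ℝ S.uB) p :=
  (contDiffAt_uB hp).fderiv_right (by norm_num)

theorem fderiv_F (hp : p ∈ S.region) (u : Phase n) :
    fderiv ℝ (fun x => S.F x p.2) p.1 u = fderiv ℝ S.uF p (u, 0) := by
  have h : HasFDerivAt S.uF (fderiv ℝ S.uF p) (p.1, p.2) :=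
    ((contDiffAt_uF hp).differentiableAt (by simp)).hasFDerivAt
  have := (HasFDerivAt.comp (g := S.uF) (f := fun x => (x, p.2)) p.1 h (hasFDerivAt_prodMk_left p.1 p.2)).fderiv
  exact congrArg (fun L => L u) this

theorem fderiv_B (hp : p ∈ S.region) (u : Phase n) :
    fderiv ℝ (fun x => S.B x p.2) p.1 u = fderiv ℝ S.uB p (u, 0) := by
  have h : HasFDerivAt S.uB (fderiv ℝ S.uB p) (p.1, p.2) :=
    ((contDiffAt_uB hp).differentiableAt (by simp)).hasFDerivAt
  have := (HasFDerivAt.comp (g := S.uB) (f := fun x => (x, p.2)) p.1 h (hasFDerivAt_prodMk_left p.1 p.2)).fderiv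
  exact congrArg (fun L => L u) this

theorem deriv_F (hp : p ∈ S.region) :
    deriv (fun s => S.F p.1 s) p.2 = fderiv ℝ S.uF p (0, 1) := by
  have h : HasFDerivAt S.uF (fderiv ℝ S.uF p) (p.1, p.2) :=
    ((contDiffAt_uF hp).differentiableAt (by simp)).hasFDerivAt
  exact (h.comp_hasDerivAt p.2 ((hasDerivAt_const p.2 p.1).prodMk (hasDerivAt_id p.2))).deriv

theorem dotProduct_K_mulVec (hp : p ∈ S.region) (u v : Phase n) :
    u ⬝ᵥ S.K p.1 p.2 *ᵥ v = fderiv ℝ S.uF p (u, 0) ⬝ᵥ v - fderiv ℝ S.uF p (v, 0) ⬝ᵥ u := by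
  rw [K, dotProduct_birkhoffMatrix_mulVec, fderiv_F hp, fderiv_F hp]

theorem dotProduct_force (hp : p ∈ S.region) (u : Phase n) :
    u ⬝ᵥ S.force p.1 p.2 = fderiv ℝ S.uB p (u, 0) + fderiv ℝ S.uF p (0, 1) ⬝ᵥ u := by
  rw [force, dotProduct_add, dotProduct_comm, grad_dotProduct, fderiv_B hp, deriv_F hp,
    dotProduct_comm u]

theorem K_mulVec_field (hp : p ∈ S.region) : S.K p.1 p.2 *ᵥ S.field p = S.force p.1 p.2 := by
  have h : IsUnit (S.K p.1 p.2).det := isUnit_iff_ne_zero.2 (S.regular p.1 p.2 hp)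
  rw [field, Matrix.mulVec_mulVec, Matrix.mul_nonsing_inv _ h, Matrix.one_mulVec]

theorem eq_field_of_equation (hp : p ∈ S.region) {v : Phase n}
    (h : S.K p.1 p.2 *ᵥ v - S.force p.1 p.2 = 0) : v = S.field p := by
  have hu : IsUnit (S.K p.1 p.2).det := isUnit_iff_ne_zero.2 (S.regular p.1 p.2 hp)
  rw [field, ← sub_eq_zero.1 h, Matrix.mulVec_mulVec, Matrix.nonsing_inv_mul _ hu,
    Matrix.one_mulVec]

/-- Birkhoff's equations, as an identity between the first derivatives of `F` and `B`. -/
theorem fderiv_dotProduct_field (hp : p ∈ S.region) (u : Phase n) :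
    fderiv ℝ S.uF p (u, 0) ⬝ᵥ S.field p =
      fderiv ℝ S.uB p (u, 0) + fderiv ℝ S.uF p (S.field p, 1) ⬝ᵥ u := by
  have h := congrArg (fun w => u ⬝ᵥ w) (K_mulVec_field hp)
  simp only [dotProduct_K_mulVec hp, dotProduct_force hp] at h
  have h2 : (S.field p, (1 : ℝ)) = (S.field p, 0) + (0, 1) := by simp
  rw [h2, map_add, add_dotProduct]
  linarith

theorem contDiffAt_field (hp : p ∈ S.region) : ContDiffAt ℝ 1 S.field p := by
  have hF : ∀ (c : Phase n × ℝ) (i : Fin (2 * n)),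
      ContDiffAt ℝ 1 (fun q => fderiv ℝ S.uF q c i) p := fun c i =>
    contDiffAt_pi.1 ((contDiffAt_fderiv_uF hp).clm_apply contDiffAt_const) i
  have hB : ∀ c : Phase n × ℝ, ContDiffAt ℝ 1 (fun q => fderiv ℝ S.uB q c) p := fun c =>
    (contDiffAt_fderiv_uB hp).clm_apply contDiffAt_const
  have hK : ∀ i j, ContDiffAt ℝ 1 (fun q : Phase n × ℝ => S.K q.1 q.2 i j) p := by
    intro i j
    refine ((hF (Pi.single i 1, 0) j).sub (hF (Pi.single j 1, 0) i)).congr_of_eventuallyEq ?_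
    filter_upwards [S.isOpen_region.mem_nhds hp] with q hq
    simp [K, birkhoffMatrix, jacobian, fderiv_F hq]
  have hf : ∀ i, ContDiffAt ℝ 1 (fun q : Phase n × ℝ => S.force q.1 q.2 i) p := by
    intro i
    refine ((hB (Pi.single i 1, 0)).add (hF (0, 1) i)).congr_of_eventuallyEq ?_
    filter_upwards [S.isOpen_region.mem_nhds hp] with q hq
    simp [force, grad, fderiv_B hq, deriv_F hq]
  refine contDiffAt_pi.2 fun i => ?_
  simp only [field, Matrix.mulVec, _root_.dotProduct]
  exact ContDiffAt.sum fun j _ =>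
    (contDiffAt_inv_entry hK (S.regular p.1 p.2 hp) i j).mul (hf j)

theorem hasDerivAt_fderiv_uF_dotProduct {c : ℝ → Phase n × ℝ} {c' : Phase n × ℝ} {t : ℝ}
    (hp : c t ∈ S.region) (hc : HasDerivAt c c' t) {u : ℝ → Phase n × ℝ} {u' : Phase n × ℝ}
    {w : ℝ → Phase n} {w' : Phase n} (hu : HasDerivAt u u' t) (hw : HasDerivAt w w' t) :
    HasDerivAt (fun s => fderiv ℝ S.uF (c s) (u s) ⬝ᵥ w s)
      ((fderiv ℝ (fderiv ℝ S.uF) (c t) c' (u t) + fderiv ℝ S.uF (c t) u') ⬝ᵥ w t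
        + fderiv ℝ S.uF (c t) (u t) ⬝ᵥ w') t := by
  have h1 : HasDerivAt (fun s => fderiv ℝ S.uF (c s)) (fderiv ℝ (fderiv ℝ S.uF) (c t) c') t :=
    ((contDiffAt_fderiv_uF hp).differentiableAt (by simp)).hasFDerivAt.comp_hasDerivAt t hc
  exact (h1.clm_apply hu).dotProduct hw

/-- Birkhoff's equations differentiated with respect to `z` in the direction `q`. -/
theorem fderiv_fderiv_dotProduct_field (hp : p ∈ S.region) (u q : Phase n) :
    fderiv ℝ (fderiv ℝ S.uF) p (q, 0) (u, 0) ⬝ᵥ S.field p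
        + fderiv ℝ S.uF p (u, 0) ⬝ᵥ spatialDeriv S.field p q =
      fderiv ℝ (fderiv ℝ S.uB) p (q, 0) (u, 0)
        + (fderiv ℝ (fderiv ℝ S.uF) p (q, 0) (S.field p, 1)
          + fderiv ℝ S.uF p (spatialDeriv S.field p q, 0)) ⬝ᵥ u := by
  -- compare the derivatives of both sides of `fderiv_dotProduct_field` along a line through `p`
  set c : ℝ → Phase n × ℝ := fun s => p + s • (q, 0) with hc
  have hc0 : c 0 = p := by simp [hc]
  have hc' : HasDerivAt c (q, 0) 0 := by
    have := ((hasDerivAt_id (0 : ℝ)).smul_const ((q, 0) : Phase n × ℝ)).const_add p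
    rwa [one_smul] at this
  have hp' : c 0 ∈ S.region := by rwa [hc0]
  have hX : HasDerivAt (fun s => S.field (c s)) (spatialDeriv S.field p q) 0 := by
    have := ((contDiffAt_field hp').differentiableAt (by simp)).hasFDerivAt.comp_hasDerivAt
      (0 : ℝ) hc'
    rw [hc0] at this
    exact this
  have hL := hasDerivAt_fderiv_uF_dotProduct hp' hc'
    (hasDerivAt_const (0 : ℝ) ((u, 0) : Phase n × ℝ)) hX
  have hB : HasDerivAt (fun s => fderiv ℝ S.uB (c s) (u, 0))
      (fderiv ℝ (fderiv ℝ S.uB) (c 0) (q, 0) (u, 0)) 0 := by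
    have := (((contDiffAt_fderiv_uB hp').differentiableAt
      (by simp)).hasFDerivAt.comp_hasDerivAt (0 : ℝ) hc').clm_apply
        (hasDerivAt_const (0 : ℝ) ((u, 0) : Phase n × ℝ))
    simpa using this
  have hR := hB.add (hasDerivAt_fderiv_uF_dotProduct hp' hc'
    (hX.prodMk (hasDerivAt_const (0 : ℝ) (1 : ℝ))) (hasDerivAt_const (0 : ℝ) u))
  have hev : (fun s => fderiv ℝ S.uF (c s) (u, 0) ⬝ᵥ S.field (c s)) =ᶠ[𝓝 0]
      fun s => fderiv ℝ S.uB (c s) (u, 0) + fderiv ℝ S.uF (c s) (S.field (c s), 1) ⬝ᵥ u := by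
    filter_upwards [hc'.continuousAt.preimage_mem_nhds (S.isOpen_region.mem_nhds hp')] with s hs
    exact fderiv_dotProduct_field hs u
  have := (hL.congr_of_eventuallyEq hev.symm).unique hR
  simpa [hc0] using this

/-- The Birkhoffian flow preserves the two-form `K`: along two solutions `P`, `Q` of the variational
equation, the value of the form is constant. Only `F ∈ C²` is needed, since the derivatives of `K`
enter through second derivatives of `F`, whose symmetry replaces the closedness of the form. -/
theorem hasDerivAt_dotProduct_K_mulVec {γ P Q : ℝ → Phase n} {t : ℝ} (hp : (γ t, t) ∈ S.region)
    (hγ : HasDerivAt γ (S.field (γ t, t)) t)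
    (hP : HasDerivAt P (spatialDeriv S.field (γ t, t) (P t)) t)
    (hQ : HasDerivAt Q (spatialDeriv S.field (γ t, t) (Q t)) t) :
    HasDerivAt (fun s => P s ⬝ᵥ S.K (γ s) s *ᵥ Q s) 0 t := by
  have hc : HasDerivAt (fun s => (γ s, s)) (S.field (γ t, t), (1 : ℝ)) t :=
    hγ.prodMk (hasDerivAt_id t)
  have h0 := hasDerivAt_const t (0 : ℝ)
  have h1 := (hasDerivAt_fderiv_uF_dotProduct (c := fun s => (γ s, s)) hp hc (hP.prodMk h0) hQ).sub
    (hasDerivAt_fderiv_uF_dotProduct (c := fun s => (γ s, s)) hp hc (hQ.prodMk h0) hP)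
  have hev : (fun s => P s ⬝ᵥ S.K (γ s) s *ᵥ Q s) =ᶠ[𝓝 t]
      fun s => fderiv ℝ S.uF (γ s, s) (P s, 0) ⬝ᵥ Q s - fderiv ℝ S.uF (γ s, s) (Q s, 0) ⬝ᵥ P s := by
    filter_upwards [hc.continuousAt.preimage_mem_nhds (S.isOpen_region.mem_nhds hp)] with s hs
    exact dotProduct_K_mulVec (p := (γ s, s)) hs _ _
  refine (h1.congr_of_eventuallyEq hev).congr_deriv ?_
  -- the identity is the difference of the two differentiated equations, with `(P, Q)` and `(Q, P)`
  have sF : ∀ a b, fderiv ℝ (fderiv ℝ S.uF) (γ t, t) a b = fderiv ℝ (fderiv ℝ S.uF) (γ t, t) b a :=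
    fun a b => (contDiffAt_uF hp).isSymmSndFDerivAt (by simp) a b
  have sB : ∀ a b, fderiv ℝ (fderiv ℝ S.uB) (γ t, t) a b = fderiv ℝ (fderiv ℝ S.uB) (γ t, t) b a :=
    fun a b => (contDiffAt_uB hp).isSymmSndFDerivAt (by simp) a b
  have e1 := fderiv_fderiv_dotProduct_field hp (P t) (Q t)
  have e2 := fderiv_fderiv_dotProduct_field hp (Q t) (P t)
  rw [sF (Q t, 0) (P t, 0), sF (Q t, 0) (_, 1), sB (Q t, 0)] at e1
  rw [sF (P t, 0) (_, 1)] at e2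
  simp only [add_dotProduct] at e1 e2 ⊢
  linarith

end System

/-! ### Potentials, block Jacobians and local inversion -/

section Potential

variable {n : ℕ}

theorem jacobian_comp {f h : Phase n → Phase n} {x : Phase n}
    (hf : DifferentiableAt ℝ f (h x)) (hh : DifferentiableAt ℝ h x) :
    jacobian (fun y => f (h y)) x = jacobian f (h x) * jacobian h x := by
  refine Matrix.ext_iff_mulVec.2 fun v => ?_
  rw [← Matrix.mulVec_mulVec, jacobian_mulVec, jacobian_mulVec, jacobian_mulVec,
    fderiv_fun_comp x hf hh]
  rfl

theorem jacobian_eq_one_of_eventuallyEq_id {h : Phase n → Phase n} {x : Phase n}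
    (hh : ∀ᶠ y in 𝓝 x, h y = y) : jacobian h x = 1 := by
  refine Matrix.ext_iff_mulVec.2 fun v => ?_
  have : h =ᶠ[𝓝 x] id := hh
  rw [jacobian_mulVec, this.fderiv_eq, fderiv_id, Matrix.one_mulVec]
  rfl

/-- The dot product as a continuous linear map into the dual space. -/
def dotL (n : ℕ) : Phase n →L[ℝ] Phase n →L[ℝ] ℝ :=
  ∑ i, (ContinuousLinearMap.proj i : Phase n →L[ℝ] ℝ).smulRight
    (ContinuousLinearMap.proj i : Phase n →L[ℝ] ℝ)

theorem dotL_apply (u v : Phase n) : dotL n u v = u ⬝ᵥ v := by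
  simp [dotL, _root_.dotProduct]

/-- A `C¹` map of a convex open set with symmetric Jacobian is the gradient map of a `C²`
function. -/
theorem exists_grad_eq_of_isSymm_jacobian {P : Set (Phase n)} (hP : IsOpen P) (hc : Convex ℝ P)
    {h : Phase n → Phase n} (hh : ContDiffOn ℝ 1 h P) (hs : ∀ w ∈ P, (jacobian h w).IsSymm) :
    ∃ φ : Phase n → ℝ, ContDiffOn ℝ 2 φ P ∧ ∀ w ∈ P, grad φ w = h w := by
  have hω : ContDiffOn ℝ 1 (fun w => dotL n (h w)) P := (dotL n).contDiff.comp_contDiffOn hh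
  have hfd : ∀ w ∈ P, ∀ x y, fderiv ℝ (fun w => dotL n (h w)) w x y = jacobian h w *ᵥ x ⬝ᵥ y := by
    intro w hw x y
    have hd : HasFDerivAt h (fderiv ℝ h w) w :=
      ((hh.contDiffAt (hP.mem_nhds hw)).differentiableAt (by simp)).hasFDerivAt
    have h2 : HasFDerivAt (fun w => dotL n (h w)) ((dotL n).comp (fderiv ℝ h w)) w :=
      (dotL n).hasFDerivAt.comp w hd
    rw [h2.fderiv, ContinuousLinearMap.comp_apply, dotL_apply, jacobian_mulVec]
  obtain ⟨φ, hφ⟩ := hc.exists_forall_hasFDerivAt_of_fderiv_symmetric hP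
    (hω.differentiableOn (by simp)) (fun w hw x y => by
      rw [hfd w hw, hfd w hw, dotProduct_comm (_ *ᵥ y), dotProduct_mulVec,
        ← Matrix.mulVec_transpose, (hs w hw).eq])
  refine ⟨φ, ?_, fun w hw => ?_⟩
  · rw [show (2 : WithTop ℕ∞) = 1 + 1 by norm_num, contDiffOn_succ_iff_fderiv_of_isOpen hP]
    refine ⟨fun w hw => (hφ w hw).differentiableAt.differentiableWithinAt, by simp, ?_⟩
    exact hω.congr fun w hw => (hφ w hw).fderiv
  · ext i
    rw [grad, (hφ w hw).fderiv, dotL_apply]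
    simp

end Potential

section BlockCalculus

variable {n : ℕ} {T T' : Phase n × Phase n → Phase n × Phase n} {p : Phase n × Phase n}

theorem blockA_mulVec (hT : DifferentiableAt ℝ T p) (v : Phase n) :
    blockA T p *ᵥ v = (fderiv ℝ T p (v, 0)).1 := by
  have h := (HasFDerivAt.comp (g := T) (f := fun x => (x, p.2)) p.1 hT.hasFDerivAt
    (hasFDerivAt_prodMk_left p.1 p.2)).fst.fderiv
  rw [blockA, jacobian_mulVec]
  exact congrArg (fun L => L v) h

theorem blockC_mulVec (hT : DifferentiableAt ℝ T p) (v : Phase n) :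
    blockC T p *ᵥ v = (fderiv ℝ T p (v, 0)).2 := by
  have h := (HasFDerivAt.comp (g := T) (f := fun x => (x, p.2)) p.1 hT.hasFDerivAt
    (hasFDerivAt_prodMk_left p.1 p.2)).snd.fderiv
  rw [blockC, jacobian_mulVec]
  exact congrArg (fun L => L v) h

theorem blockB_mulVec (hT : DifferentiableAt ℝ T p) (v : Phase n) :
    blockB T p *ᵥ v = (fderiv ℝ T p (0, v)).1 := by
  have h := (HasFDerivAt.comp (g := T) (f := fun y => (p.1, y)) p.2 hT.hasFDerivAt
    (hasFDerivAt_prodMk_right p.1 p.2)).fst.fderiv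
  rw [blockB, jacobian_mulVec]
  exact congrArg (fun L => L v) h

theorem blockD_mulVec (hT : DifferentiableAt ℝ T p) (v : Phase n) :
    blockD T p *ᵥ v = (fderiv ℝ T p (0, v)).2 := by
  have h := (HasFDerivAt.comp (g := T) (f := fun y => (p.1, y)) p.2 hT.hasFDerivAt
    (hasFDerivAt_prodMk_right p.1 p.2)).snd.fderiv
  rw [blockD, jacobian_mulVec]
  exact congrArg (fun L => L v) h

theorem blockA_mulVec_add_blockB_mulVec (hT : DifferentiableAt ℝ T p) (u v : Phase n) :
    blockA T p *ᵥ u + blockB T p *ᵥ v = (fderiv ℝ T p (u, v)).1 := by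
  rw [blockA_mulVec hT, blockB_mulVec hT, ← Prod.fst_add, ← map_add]
  simp

theorem blockC_mulVec_add_blockD_mulVec (hT : DifferentiableAt ℝ T p) (u v : Phase n) :
    blockC T p *ᵥ u + blockD T p *ᵥ v = (fderiv ℝ T p (u, v)).2 := by
  rw [blockC_mulVec hT, blockD_mulVec hT, ← Prod.snd_add, ← map_add]
  simp

/-- The block Jacobians of a map and of a left inverse are inverse to each other. -/
theorem block_mul_block_of_leftInverse (hT : DifferentiableAt ℝ T p)
    (hT' : DifferentiableAt ℝ T' (T p)) (hinv : ∀ᶠ x in 𝓝 p, T' (T x) = x) :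
    blockA T' (T p) * blockA T p + blockB T' (T p) * blockC T p = 1 ∧
    blockA T' (T p) * blockB T p + blockB T' (T p) * blockD T p = 0 ∧
    blockC T' (T p) * blockA T p + blockD T' (T p) * blockC T p = 0 ∧
    blockC T' (T p) * blockB T p + blockD T' (T p) * blockD T p = 1 := by
  have hcomp : ∀ u, fderiv ℝ T' (T p) (fderiv ℝ T p u) = u := by
    intro u
    have h1 : (fun x => T' (T x)) =ᶠ[𝓝 p] id := hinv
    have h2 := h1.fderiv_eq (𝕜 := ℝ)
    rw [fderiv_fun_comp p hT' hT, fderiv_id] at h2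
    exact congrArg (fun L => L u) h2
  refine ⟨?_, ?_, ?_, ?_⟩ <;> refine Matrix.ext_iff_mulVec.2 fun v => ?_ <;>
    simp only [Matrix.add_mulVec, ← Matrix.mulVec_mulVec, blockA_mulVec_add_blockB_mulVec hT',
      blockC_mulVec_add_blockD_mulVec hT', blockA_mulVec hT, blockB_mulVec hT, blockC_mulVec hT,
      blockD_mulVec hT, Prod.mk.eta, hcomp, Matrix.one_mulVec, Matrix.zero_mulVec]

end BlockCalculus

section MatrixAlgebra

variable {ι : Type*} [Fintype ι] [DecidableEq ι]

/-- If the block matrix `(A, B; C, D)` pulls `J₄ₙ` back to `diag (K, -K₀)` and `Mᵀ K M = K₀`, then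
the graph of `M` is mapped to a Lagrangian subspace. -/
theorem transpose_mul_eq_transpose_mul_of_lagrangian {A B C D K K₀ M : Matrix ι ι ℝ}
    (h : (fromBlocks A B C D)ᵀ * fromBlocks 0 1 (-1) 0 * fromBlocks A B C D
      = fromBlocks K 0 0 (-K₀)) (hM : Mᵀ * K * M = K₀) :
    (A * M + B)ᵀ * (C * M + D) = (C * M + D)ᵀ * (A * M + B) := by
  simp only [fromBlocks_transpose, fromBlocks_multiply, fromBlocks_inj, mul_zero, mul_one,
    zero_add, add_zero, mul_neg, neg_mul] at h
  obtain ⟨h1, h2, h3, h4⟩ := h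
  rw [← sub_eq_zero]
  calc (A * M + B)ᵀ * (C * M + D) - (C * M + D)ᵀ * (A * M + B)
      = Mᵀ * (-(Cᵀ * A) + Aᵀ * C) * M + Mᵀ * (-(Cᵀ * B) + Aᵀ * D)
        + (-(Dᵀ * A) + Bᵀ * C) * M + (-(Dᵀ * B) + Bᵀ * D) := by
        simp only [transpose_add, transpose_mul]
        noncomm_ring
    _ = 0 := by rw [h1, h2, h3, h4, hM]; simp

theorem isSymm_mul_nonsing_inv {R S : Matrix ι ι ℝ} (hS : S.det ≠ 0) (h : Rᵀ * S = Sᵀ * R) :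
    (R * S⁻¹).IsSymm := by
  have hu : IsUnit S.det := isUnit_iff_ne_zero.2 hS
  have hu' : IsUnit Sᵀ.det := by rwa [det_transpose]
  rw [Matrix.IsSymm, transpose_mul, transpose_nonsing_inv]
  calc Sᵀ⁻¹ * Rᵀ = Sᵀ⁻¹ * (Rᵀ * S) * S⁻¹ := by
        rw [mul_assoc, mul_assoc, mul_nonsing_inv _ hu, mul_one]
    _ = R * S⁻¹ := by rw [h, ← mul_assoc, nonsing_inv_mul _ hu', one_mul]

end MatrixAlgebra

/-- The inverse function theorem in finite dimension, with a `C¹` inverse on a neighbourhood. -/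
theorem exists_local_inverse_of_injective {E : Type*} [NormedAddCommGroup E] [NormedSpace ℝ E]
    [FiniteDimensional ℝ E] {f : E → E} {a : E} (hf : ContDiffAt ℝ 1 f a)
    (hinj : Function.Injective (fderiv ℝ f a)) :
    ∃ e : OpenPartialHomeomorph E E, (∀ x, e x = f x) ∧ a ∈ e.source ∧
      ∀ᶠ y in 𝓝 (f a), ContDiffAt ℝ 1 e.symm y := by
  have : CompleteSpace E := FiniteDimensional.complete ℝ E
  let L : E ≃L[ℝ] E :=
    (LinearEquiv.ofInjectiveEndo (fderiv ℝ f a : E →ₗ[ℝ] E) hinj).toContinuousLinearEquiv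
  have hL : HasFDerivAt f (L : E →L[ℝ] E) a := by
    have h : (L : E →L[ℝ] E) = fderiv ℝ f a := by ext x; rfl
    rw [h]
    exact (hf.differentiableAt (by simp)).hasFDerivAt
  refine ⟨hf.toOpenPartialHomeomorph f hL (by simp), fun x => rfl,
    hf.mem_toOpenPartialHomeomorph_source hL (by simp), ?_⟩
  exact (hf.to_localInverse hL (by simp)).eventually (by simp)

/-! ### The flow near the initial point and the chain rule through `α` -/

variable {n : ℕ} {S : System n}

/-- Near `(z₀, t₀)` the phase flow is `C¹`, and its Jacobian `M` satisfies
`Mᵀ K(ẑ,t) M = K(z,t₀)`. -/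
theorem System.IsPhaseFlow.exists_contDiffAt {W : Set (Phase n × ℝ × ℝ)}
    {g : Phase n → ℝ → ℝ → Phase n} (hg : S.IsPhaseFlow W g) {z₀ : Phase n} {t₀ : ℝ}
    (hz₀ : (z₀, t₀) ∈ S.region) :
    ∃ r > 0, ∃ δ > 0, ∀ z ∈ ball z₀ r, (z, t₀) ∈ S.region ∧ ∀ t ∈ Ioo (t₀ - δ) (t₀ + δ),
      (z, t, t₀) ∈ W ∧ HasDerivAt (fun s => g z s t₀) (S.field (g z t t₀, t)) t ∧
      ContDiffAt ℝ 1 (fun p : Phase n × ℝ => g p.1 p.2 t₀) (z, t) ∧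
      (jacobian (fun x => g x t t₀) z)ᵀ * S.K (g z t t₀) t * jacobian (fun x => g x t t₀) z
        = S.K z t₀ := by
  have hreg : ∀ᶠ z in 𝓝 z₀, (z, t₀) ∈ S.region :=
    (Continuous.prodMk_left t₀).continuousAt.preimage_mem_nhds (S.isOpen_region.mem_nhds hz₀)
  have hW : ∀ᶠ p : Phase n × ℝ in 𝓝 (z₀, t₀), (p.1, p.2, t₀) ∈ W := by
    have hc : Continuous fun p : Phase n × ℝ => (p.1, p.2, t₀) := by fun_prop
    exact hc.continuousAt.preimage_mem_nhds (hg.isOpen.mem_nhds (hg.initial_mem z₀ t₀ hz₀))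
  have hder : ∀ z t, (z, t, t₀) ∈ W →
      HasDerivAt (fun s => g z s t₀) (S.field (g z t t₀, t)) t := by
    intro z t h
    rw [← System.eq_field_of_equation (p := (g z t t₀, t)) (hg.mem_region z t t₀ h)
      (hg.equation z t t₀ h)]
    exact (hg.differentiableAt z t t₀ h).hasDerivAt
  obtain ⟨r₁, hr₁, δ₁, hδ₁, M, hM⟩ := exists_contDiffAt_flow (g := fun z t => g z t t₀)
    (System.contDiffAt_field hz₀)
    (hreg.mono fun z hz => hg.initial_eq z t₀ (hg.initial_mem z t₀ hz))
    (hW.mono fun p hp => hder p.1 p.2 hp)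
  obtain ⟨ε, hε, hεW⟩ := Metric.eventually_nhds_iff_ball.1 (hW.and (hreg.prod_inl_nhds t₀))
  refine ⟨min r₁ ε, lt_min hr₁ hε, min δ₁ ε, lt_min hδ₁ hε, fun z hz => ?_⟩
  have hz1 : z ∈ ball z₀ r₁ := ball_subset_ball (min_le_left _ _) hz
  have hz2 : z ∈ ball z₀ ε := ball_subset_ball (min_le_right _ _) hz
  have hWt : ∀ t ∈ Ioo (t₀ - min δ₁ ε) (t₀ + min δ₁ ε), (z, t, t₀) ∈ W := by
    intro t ht
    refine (hεW (z, t) ?_).1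
    rw [← Real.ball_eq_Ioo] at ht
    rw [mem_ball, Prod.dist_eq]
    exact max_lt hz2 (lt_of_lt_of_le ht (min_le_right _ _))
  have hsub : Ioo (t₀ - min δ₁ ε) (t₀ + min δ₁ ε) ⊆ Ioo (t₀ - δ₁) (t₀ + δ₁) :=
    Ioo_subset_Ioo (by linarith [min_le_left δ₁ ε]) (by linarith [min_le_left δ₁ ε])
  have hzreg : (z, t₀) ∈ S.region := by
    refine (hεW (z, t₀) ?_).2
    rw [mem_ball, Prod.dist_eq]
    exact max_lt hz2 (by simpa using hε)
  have ht₀ : t₀ ∈ Ioo (t₀ - min δ₁ ε) (t₀ + min δ₁ ε) :=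
    ⟨by linarith [lt_min hδ₁ hε], by linarith [lt_min hδ₁ hε]⟩
  refine ⟨hzreg, fun t ht => ⟨hWt t ht, hder z t (hWt t ht), ((hM z hz1).2 t (hsub ht)).2.2, ?_⟩⟩
  have hconst : ∀ a b : Phase n, M z t a ⬝ᵥ S.K (g z t t₀) t *ᵥ M z t b = a ⬝ᵥ S.K z t₀ *ᵥ b := by
    intro a b
    have hd : ∀ s ∈ Ioo (t₀ - min δ₁ ε) (t₀ + min δ₁ ε),
        HasDerivAt (fun s => M z s a ⬝ᵥ S.K (g z s t₀) s *ᵥ M z s b) 0 s := by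
      intro s hs
      have hMs : ∀ c : Phase n, HasDerivAt (fun s => M z s c)
          (spatialDeriv S.field (g z s t₀, s) (M z s c)) s := fun c =>
        (((hM z hz1).2 s (hsub hs)).2.1.clm_apply (hasDerivAt_const s c)).congr_deriv (by simp)
      exact System.hasDerivAt_dotProduct_K_mulVec (γ := fun s => g z s t₀)
        (hg.mem_region z s t₀ (hWt s hs)) (hder z s (hWt s hs)) (hMs a) (hMs b)
    have := isOpen_Ioo.is_const_of_deriv_eq_zero isPreconnected_Ioo
      (fun s hs => (hd s hs).differentiableAt.differentiableWithinAt)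
      (fun s hs => (hd s hs).deriv) ht ht₀
    simpa [(hM z hz1).1, hg.initial_eq z t₀ (hg.initial_mem z t₀ hzreg)] using this
  have hJ : ∀ a, jacobian (fun x => g x t t₀) z *ᵥ a = M z t a := fun a => by
    rw [jacobian_mulVec, ((hM z hz1).2 t (hsub ht)).1.fderiv]
  refine Matrix.ext_iff_mulVec.2 fun b => ?_
  refine dotProduct_eq _ _ fun a => ?_
  rw [dotProduct_comm, dotProduct_comm _ a, ← hconst a b, ← hJ a, ← hJ b,
    ← Matrix.mulVec_mulVec, ← Matrix.mulVec_mulVec, dotProduct_mulVec a, Matrix.vecMul_transpose]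

namespace Transformation

variable {α : Transformation S}

theorem isOpen_domain (S : System n) (t₀ : ℝ) :
    IsOpen {q : (Phase n × Phase n) × ℝ | (q.1.1, q.2) ∈ S.region ∧ (q.1.2, t₀) ∈ S.region} := by
  have h1 : Continuous fun q : (Phase n × Phase n) × ℝ => (q.1.1, q.2) := by fun_prop
  have h2 : Continuous fun q : (Phase n × Phase n) × ℝ => (q.1.2, t₀) := by fun_prop
  exact (S.isOpen_region.preimage h1).inter (S.isOpen_region.preimage h2)

theorem mem_source {zhat z : Phase n} {t t₀ : ℝ} (h1 : (zhat, t) ∈ S.region)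
    (h2 : (z, t₀) ∈ S.region) : (zhat, z) ∈ (α.toFun t t₀).source := by
  rw [α.source_eq]; exact ⟨h1, h2⟩

theorem contDiffAt_uncurry {zhat z : Phase n} {t t₀ : ℝ} (h1 : (zhat, t) ∈ S.region)
    (h2 : (z, t₀) ∈ S.region) :
    ContDiffAt ℝ 1 (fun q : (Phase n × Phase n) × ℝ => α.toFun q.2 t₀ q.1) ((zhat, z), t) :=
  (α.contDiffOn t₀).contDiffAt ((isOpen_domain S t₀).mem_nhds ⟨h1, h2⟩)

theorem fderiv_toFun {zhat z : Phase n} {t t₀ : ℝ} (h1 : (zhat, t) ∈ S.region)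
    (h2 : (z, t₀) ∈ S.region) :
    HasFDerivAt (α.toFun t t₀) ((fderiv ℝ (fun q : (Phase n × Phase n) × ℝ => α.toFun q.2 t₀ q.1)
      ((zhat, z), t)).comp (ContinuousLinearMap.inl ℝ _ ℝ)) (zhat, z) :=
  HasFDerivAt.comp (g := fun q : (Phase n × Phase n) × ℝ => α.toFun q.2 t₀ q.1)
    (f := fun x => (x, t)) (zhat, z)
    ((contDiffAt_uncurry h1 h2).differentiableAt (by simp)).hasFDerivAt
    (hasFDerivAt_prodMk_left (zhat, z) t)

/-- The chain rule for `α₁` and `α₂` along a solution of Birkhoff's equations: `Ā` is the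
combination `dŵ/dt - N dw/dt` of the derivatives along the flow. -/
theorem exists_hasDerivAt_along {γ : ℝ → Phase n} {z : Phase n} {t t₀ : ℝ}
    (h1 : (γ t, t) ∈ S.region) (h2 : (z, t₀) ∈ S.region)
    (hγ : HasDerivAt γ (S.field (γ t, t)) t) :
    ∃ a b : Phase n, HasDerivAt (fun s => α.fst (γ s) z s t₀) a t ∧
      HasDerivAt (fun s => α.snd (γ s) z s t₀) b t ∧
      ∀ N, α.calAbar (γ t) z N t t₀ = a - N *ᵥ b := by
  set Φ : (Phase n × Phase n) × ℝ → Phase n × Phase n := fun q => α.toFun q.2 t₀ q.1 with hΦ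
  have hD : HasFDerivAt Φ (fderiv ℝ Φ ((γ t, z), t)) ((γ t, z), t) :=
    ((contDiffAt_uncurry h1 h2).differentiableAt (by simp)).hasFDerivAt
  have htot : HasDerivAt (fun s => Φ ((γ s, z), s))
      (fderiv ℝ Φ ((γ t, z), t) ((S.field (γ t, t), 0), 1)) t :=
    HasFDerivAt.comp_hasDerivAt (l := Φ) (f := fun s => ((γ s, z), s)) t hD
      ((hγ.prodMk (hasDerivAt_const t z)).prodMk (hasDerivAt_id t))
  have hpart : HasDerivAt (fun s => Φ ((γ t, z), s)) (fderiv ℝ Φ ((γ t, z), t) (0, 1)) t :=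
    HasFDerivAt.comp_hasDerivAt (l := Φ) (f := fun s => ((γ t, z), s)) t hD
      ((hasDerivAt_const t (γ t, z)).prodMk (hasDerivAt_id t))
  have hT := fderiv_toFun (α := α) h1 h2
  have hsplit : fderiv ℝ Φ ((γ t, z), t) ((S.field (γ t, t), 0), 1) =
      fderiv ℝ (α.toFun t t₀) (γ t, z) (S.field (γ t, t), 0)
        + fderiv ℝ Φ ((γ t, z), t) (0, 1) := by
    rw [hT.fderiv, ContinuousLinearMap.comp_apply, ← map_add]
    simp [hΦ]
  have hfst : ∀ {c : ℝ → Phase n × Phase n} {c' : Phase n × Phase n}, HasDerivAt c c' t →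
      HasDerivAt (fun s => (c s).1) c'.1 t := fun hc =>
    (ContinuousLinearMap.fst ℝ (Phase n) (Phase n)).hasFDerivAt.comp_hasDerivAt t hc
  have hsnd : ∀ {c : ℝ → Phase n × Phase n} {c' : Phase n × Phase n}, HasDerivAt c c' t →
      HasDerivAt (fun s => (c s).2) c'.2 t := fun hc =>
    (ContinuousLinearMap.snd ℝ (Phase n) (Phase n)).hasFDerivAt.comp_hasDerivAt t hc
  refine ⟨_, _, hfst htot, hsnd htot, fun N => ?_⟩
  have e1 : deriv (fun s => α.fst (γ t) z s t₀) t = (fderiv ℝ Φ ((γ t, z), t) (0, 1)).1 :=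
    (hfst hpart).deriv
  have e2 : deriv (fun s => α.snd (γ t) z s t₀) t = (fderiv ℝ Φ ((γ t, z), t) (0, 1)).2 :=
    (hsnd hpart).deriv
  have e3 : (S.K (γ t) t)⁻¹ *ᵥ S.force (γ t) t = S.field (γ t, t) := rfl
  rw [calAbar, e1, e2, e3, hsplit, Prod.fst_add, Prod.snd_add, A, C, Matrix.sub_mulVec,
    ← Matrix.mulVec_mulVec, blockA_mulVec hT.differentiableAt, blockC_mulVec hT.differentiableAt,
    Matrix.mulVec_add]
  abel

theorem jacobian_fst_comp {γ : Phase n → Phase n} {z : Phase n} {t t₀ : ℝ}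
    (h1 : (γ z, t) ∈ S.region) (h2 : (z, t₀) ∈ S.region) (hγ : DifferentiableAt ℝ γ z) :
    jacobian (fun x => α.fst (γ x) x t t₀) z =
      α.A (γ z) z t t₀ * jacobian γ z + α.B (γ z) z t t₀ := by
  have hT := (fderiv_toFun (α := α) h1 h2).differentiableAt
  refine Matrix.ext_iff_mulVec.2 fun v => ?_
  have h := (HasFDerivAt.comp (g := α.toFun t t₀) (f := fun x => (γ x, x)) z hT.hasFDerivAt
    (hγ.hasFDerivAt.prodMk (hasFDerivAt_id z))).fst.fderiv
  rw [Matrix.add_mulVec, ← Matrix.mulVec_mulVec, jacobian_mulVec, jacobian_mulVec, A, B,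
    blockA_mulVec_add_blockB_mulVec hT]
  exact congrArg (fun L => L v) h

theorem jacobian_snd_comp {γ : Phase n → Phase n} {z : Phase n} {t t₀ : ℝ}
    (h1 : (γ z, t) ∈ S.region) (h2 : (z, t₀) ∈ S.region) (hγ : DifferentiableAt ℝ γ z) :
    jacobian (fun x => α.snd (γ x) x t t₀) z =
      α.C (γ z) z t t₀ * jacobian γ z + α.D (γ z) z t t₀ := by
  have hT := (fderiv_toFun (α := α) h1 h2).differentiableAt
  refine Matrix.ext_iff_mulVec.2 fun v => ?_
  have h := (HasFDerivAt.comp (g := α.toFun t t₀) (f := fun x => (γ x, x)) z hT.hasFDerivAt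
    (hγ.hasFDerivAt.prodMk (hasFDerivAt_id z))).snd.fderiv
  rw [Matrix.add_mulVec, ← Matrix.mulVec_mulVec, jacobian_mulVec, jacobian_mulVec, C, D,
    blockC_mulVec_add_blockD_mulVec hT]
  exact congrArg (fun L => L v) h

/-- If `N` is the linear fractional transform of `M` under the Jacobian of `α`, then `M` is that of
`N` under the Jacobian of `α⁻¹`. -/
theorem inverse_fractional_transform {zhat z : Phase n} {t t₀ : ℝ} (h1 : (zhat, t) ∈ S.region)
    (h2 : (z, t₀) ∈ S.region) {M N : Matrix (Fin (2 * n)) (Fin (2 * n)) ℝ}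
    (hN : N * (α.C zhat z t t₀ * M + α.D zhat z t t₀) = α.A zhat z t t₀ * M + α.B zhat z t t₀) :
    (α.invC (α.fst zhat z t t₀) (α.snd zhat z t t₀) t t₀ * N
        + α.invD (α.fst zhat z t t₀) (α.snd zhat z t t₀) t t₀).det ≠ 0 ∧
      M = (α.invA (α.fst zhat z t t₀) (α.snd zhat z t t₀) t t₀ * N
          + α.invB (α.fst zhat z t t₀) (α.snd zhat z t t₀) t t₀) *
        (α.invC (α.fst zhat z t t₀) (α.snd zhat z t t₀) t t₀ * N
          + α.invD (α.fst zhat z t t₀) (α.snd zhat z t t₀) t t₀)⁻¹ := by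
  have hsrc := mem_source (α := α) h1 h2
  have htgt := (α.toFun t t₀).map_source hsrc
  obtain ⟨i1, i2, i3, i4⟩ := block_mul_block_of_leftInverse (T := α.toFun t t₀)
    (T' := (α.toFun t t₀).symm) (fderiv_toFun h1 h2).differentiableAt
    (((α.contDiffOn_symm t t₀).contDiffAt
      ((α.toFun t t₀).open_target.mem_nhds htgt)).differentiableAt (by simp))
    ((α.toFun t t₀).eventually_left_inverse hsrc)
  simp only [A, B, C, D] at hN ⊢
  simp only [invA, invB, invC, invD, fst, snd, Prod.mk.eta]
  set a := blockA (α.toFun t t₀) (zhat, z)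
  set b := blockB (α.toFun t t₀) (zhat, z)
  set c := blockC (α.toFun t t₀) (zhat, z)
  set d := blockD (α.toFun t t₀) (zhat, z)
  set a' := blockA (α.toFun t t₀).symm (α.toFun t t₀ (zhat, z))
  set b' := blockB (α.toFun t t₀).symm (α.toFun t t₀ (zhat, z))
  set c' := blockC (α.toFun t t₀).symm (α.toFun t t₀ (zhat, z))
  set d' := blockD (α.toFun t t₀).symm (α.toFun t t₀ (zhat, z))
  have hone : (c' * N + d') * (c * M + d) = 1 := by
    calc (c' * N + d') * (c * M + d) = c' * (N * (c * M + d)) + d' * (c * M + d) := by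
          noncomm_ring
      _ = (c' * a + d' * c) * M + (c' * b + d' * d) := by rw [hN]; noncomm_ring
      _ = 1 := by rw [i3, i4]; simp
  have hM : (a' * N + b') * (c * M + d) = M := by
    calc (a' * N + b') * (c * M + d) = a' * (N * (c * M + d)) + b' * (c * M + d) := by
          noncomm_ring
      _ = (a' * a + b' * c) * M + (a' * b + b' * d) := by rw [hN]; noncomm_ring
      _ = M := by rw [i1, i2]; simp
  refine ⟨fun h0 => ?_, ?_⟩
  · have := congrArg Matrix.det hone
    rw [det_mul, h0, zero_mul, det_one] at this
    exact zero_ne_one this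
  · rw [Matrix.inv_eq_right_inv hone, hM]

end Transformation

/-! ### The generating map -/

/-- Existence of a map `f` with `ŵ = f(w,t)` along the flow. Its Jacobian is symmetric, and it solves
the Hamilton-Jacobi type equation; `P` is convex, so that a potential exists on it. -/
theorem Transformation.exists_generating_map (α : Transformation S)
    {W : Set (Phase n × ℝ × ℝ)} {g : Phase n → ℝ → ℝ → Phase n} (hg : S.IsPhaseFlow W g)
    {z₀ : Phase n} {t₀ : ℝ} (hz₀ : (z₀, t₀) ∈ S.region)
    (hCD : (α.C z₀ z₀ t₀ t₀ + α.D z₀ z₀ t₀ t₀).det ≠ 0) :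
    ∃ (δ : ℝ) (U P : Set (Phase n)) (f : Phase n → ℝ → Phase n),
      0 < δ ∧ IsOpen U ∧ z₀ ∈ U ∧ IsOpen P ∧ Convex ℝ P ∧ α.snd z₀ z₀ t₀ t₀ ∈ P ∧
      ContDiffOn ℝ 1 (fun q : Phase n × ℝ => f q.1 q.2) (P ×ˢ {t : ℝ | |t - t₀| < δ}) ∧
      (∀ t : ℝ, |t - t₀| < δ → ∀ w ∈ P,
        (jacobian (fun x => f x t) w).IsSymm ∧ (f w t, w) ∈ (α.toFun t t₀).target ∧
        HasDerivAt (fun s => f w s) (α.calA (f w t) w (jacobian (fun x => f x t) w) t t₀) t) ∧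
      (∀ t : ℝ, |t - t₀| < δ → ∀ z ∈ U,
        (z, t, t₀) ∈ W ∧ DifferentiableAt ℝ (fun x => g x t t₀) z ∧
        HasDerivAt (fun s => g z s t₀) (S.field (g z t t₀, t)) t ∧ (z, t₀) ∈ S.region ∧
        α.snd (g z t t₀) z t t₀ ∈ P ∧
        α.fst (g z t t₀) z t t₀ = f (α.snd (g z t t₀) z t t₀) t ∧
        (α.C (g z t t₀) z t t₀ * jacobian (fun x => g x t t₀) z + α.D (g z t t₀) z t t₀).det ≠ 0 ∧
        jacobian (fun x => f x t) (α.snd (g z t t₀) z t t₀) *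
            (α.C (g z t t₀) z t t₀ * jacobian (fun x => g x t t₀) z + α.D (g z t t₀) z t t₀) =
          α.A (g z t t₀) z t t₀ * jacobian (fun x => g x t t₀) z + α.B (g z t t₀) z t t₀) := by
  obtain ⟨r, hr, δ₀, hδ₀, hbox⟩ := hg.exists_contDiffAt hz₀
  set G : Set (Phase n × ℝ) := ball z₀ r ×ˢ Ioo (t₀ - δ₀) (t₀ + δ₀) with hG
  have hGo : IsOpen G := isOpen_ball.prod isOpen_Ioo
  have hx₀ : (z₀, t₀) ∈ G := by
    refine ⟨mem_ball_self hr, ?_, ?_⟩ <;> simp only <;> linarith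
  -- `a (z, t) = (ŵ, w)`
  set a : Phase n × ℝ → Phase n × Phase n :=
    fun p => α.toFun p.2 t₀ (g p.1 p.2 t₀, p.1) with ha
  have hreg : ∀ p ∈ G, (g p.1 p.2 t₀, p.2) ∈ S.region ∧ (p.1, t₀) ∈ S.region := fun p hp =>
    ⟨hg.mem_region p.1 p.2 t₀ ((hbox p.1 hp.1).2 p.2 hp.2).1, (hbox p.1 hp.1).1⟩
  have hgC : ∀ p ∈ G, ContDiffAt ℝ 1 (fun p : Phase n × ℝ => g p.1 p.2 t₀) p := fun p hp =>
    ((hbox p.1 hp.1).2 p.2 hp.2).2.2.1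
  have hgz : ∀ p ∈ G, DifferentiableAt ℝ (fun x => g x p.2 t₀) p.1 := fun p hp =>
    DifferentiableAt.comp (g := fun p : Phase n × ℝ => g p.1 p.2 t₀) (f := fun x => (x, p.2)) p.1
      ((hgC p hp).differentiableAt (by simp)) (by fun_prop)
  have haC : ∀ p ∈ G, ContDiffAt ℝ 1 a p := fun p hp =>
    ContDiffAt.comp (g := fun q : (Phase n × Phase n) × ℝ => α.toFun q.2 t₀ q.1)
      (f := fun p : Phase n × ℝ => ((g p.1 p.2 t₀, p.1), p.2)) p
      (contDiffAt_uncurry (hreg p hp).1 (hreg p hp).2)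
      (((hgC p hp).prodMk contDiffAt_fst).prodMk contDiffAt_snd)
  -- the Jacobians of `z ↦ ŵ` and `z ↦ w` are `A M + B` and `C M + D`
  have hJR : ∀ p ∈ G, jacobian (fun x => (a (x, p.2)).1) p.1 =
      α.A (g p.1 p.2 t₀) p.1 p.2 t₀ * jacobian (fun x => g x p.2 t₀) p.1
        + α.B (g p.1 p.2 t₀) p.1 p.2 t₀ := fun p hp =>
    jacobian_fst_comp (γ := fun x => g x p.2 t₀) (hreg p hp).1 (hreg p hp).2 (hgz p hp)
  have hJS : ∀ p ∈ G, jacobian (fun x => (a (x, p.2)).2) p.1 =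
      α.C (g p.1 p.2 t₀) p.1 p.2 t₀ * jacobian (fun x => g x p.2 t₀) p.1
        + α.D (g p.1 p.2 t₀) p.1 p.2 t₀ := fun p hp =>
    jacobian_snd_comp (γ := fun x => g x p.2 t₀) (hreg p hp).1 (hreg p hp).2 (hgz p hp)
  have hslice : ∀ p ∈ G, DifferentiableAt ℝ (fun x => a (x, p.2)) p.1 := fun p hp =>
    DifferentiableAt.comp (g := a) (f := fun x => (x, p.2)) p.1
      ((haC p hp).differentiableAt (by simp)) (by fun_prop)
  have hg₀ : ∀ z ∈ ball z₀ r, g z t₀ t₀ = z := fun z hz =>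
    hg.initial_eq z t₀ (hg.initial_mem z t₀ (hbox z hz).1)
  set w₀ := α.snd z₀ z₀ t₀ t₀ with hw₀
  have haw₀ : (a (z₀, t₀)).2 = w₀ := by
    simp only [ha, hw₀, snd, hg₀ z₀ (mem_ball_self hr)]
  -- local inversion of `(z, t) ↦ (w, t)`
  set Ψ : Phase n × ℝ → Phase n × ℝ := fun p => ((a p).2, p.2) with hΨ
  have hΨC : ContDiffAt ℝ 1 Ψ (z₀, t₀) := (haC _ hx₀).snd.prodMk contDiffAt_snd
  have hinj : Function.Injective (fderiv ℝ Ψ (z₀, t₀)) := by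
    have hd2 : DifferentiableAt ℝ (fun p => (a p).2) (z₀, t₀) :=
      (haC _ hx₀).snd.differentiableAt (by simp)
    have hfd : fderiv ℝ Ψ (z₀, t₀) = (fderiv ℝ (fun p => (a p).2) (z₀, t₀)).prod
        (ContinuousLinearMap.snd ℝ (Phase n) ℝ) := (hd2.hasFDerivAt.prodMk hasFDerivAt_snd).fderiv
    have hpart : ∀ v, fderiv ℝ (fun p => (a p).2) (z₀, t₀) (v, 0) =
        (α.C z₀ z₀ t₀ t₀ + α.D z₀ z₀ t₀ t₀) *ᵥ v := by
      intro v
      have h1 := (HasFDerivAt.comp (g := fun p => (a p).2) (f := fun x => (x, t₀)) z₀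
        hd2.hasFDerivAt (hasFDerivAt_prodMk_left z₀ t₀)).fderiv
      have h2 := hJS _ hx₀
      simp only [jacobian_eq_one_of_eventuallyEq_id
        (eventually_of_mem (isOpen_ball.mem_nhds (mem_ball_self hr)) hg₀), mul_one,
        hg₀ z₀ (mem_ball_self hr)] at h2
      rw [← h2, jacobian_mulVec]
      exact (congrArg (fun L => L v) h1).symm
    rw [injective_iff_map_eq_zero]
    rintro ⟨v, s⟩ hvs
    rw [hfd, ContinuousLinearMap.prod_apply, Prod.mk_eq_zero] at hvs
    obtain ⟨h1, h2⟩ := hvs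
    have hs : s = 0 := h2
    subst hs
    rw [hpart] at h1
    rw [Matrix.eq_zero_of_mulVec_eq_zero hCD h1]
    rfl
  obtain ⟨e, he, hes, heC⟩ := exists_local_inverse_of_injective hΨC hinj
  have hΨ₀ : Ψ (z₀, t₀) = (w₀, t₀) := by simp only [hΨ, haw₀]
  rw [hΨ₀] at heC
  have he₀ : e (z₀, t₀) = (w₀, t₀) := by rw [he, hΨ₀]
  have het : (w₀, t₀) ∈ e.target := he₀ ▸ e.map_source hes
  have hsymm₀ : e.symm (w₀, t₀) = (z₀, t₀) := by rw [← he₀, e.left_inv hes]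
  have hsymmG : ∀ᶠ q in 𝓝 (w₀, t₀), e.symm q ∈ G :=
    (e.continuousAt_symm het).preimage_mem_nhds (by rw [hsymm₀]; exact hGo.mem_nhds hx₀)
  obtain ⟨ρ, hρ, hρb⟩ := Metric.eventually_nhds_iff_ball.1
    ((heC.and (e.open_target.eventually_mem het)).and hsymmG)
  have haP : ∀ᶠ p in 𝓝 (z₀, t₀), (a p).2 ∈ ball w₀ ρ :=
    ((haC _ hx₀).continuousAt.snd).preimage_mem_nhds
      (by rw [haw₀]; exact ball_mem_nhds _ hρ)
  obtain ⟨ε, hε, hεb⟩ := Metric.eventually_nhds_iff_ball.1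
    (((e.open_source.eventually_mem hes).and haP).and (hGo.eventually_mem hx₀))
  set δ := min ε ρ with hδ
  have hP : ∀ w ∈ ball w₀ ρ, ∀ t, |t - t₀| < δ → ContDiffAt ℝ 1 e.symm (w, t) ∧
      (w, t) ∈ e.target ∧ e.symm (w, t) ∈ G := by
    intro w hw t ht
    have : (w, t) ∈ ball (w₀, t₀) ρ := by
      rw [mem_ball, Prod.dist_eq]
      exact max_lt hw (lt_of_lt_of_le ht (min_le_right _ _))
    exact ⟨(hρb _ this).1.1, (hρb _ this).1.2, (hρb _ this).2⟩
  have hU : ∀ z ∈ ball z₀ ε, ∀ t, |t - t₀| < δ → (z, t) ∈ e.source ∧ (a (z, t)).2 ∈ ball w₀ ρ ∧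
      (z, t) ∈ G := by
    intro z hz t ht
    have : (z, t) ∈ ball (z₀, t₀) ε := by
      rw [mem_ball, Prod.dist_eq]
      exact max_lt hz (lt_of_lt_of_le ht (min_le_left _ _))
    exact ⟨(hεb _ this).1.1, (hεb _ this).1.2, (hεb _ this).2⟩
  -- the inverse keeps the time coordinate
  have hright : ∀ q ∈ e.target, ((a (e.symm q)).2, (e.symm q).2) = q := fun q hq => by
    have := e.right_inv hq
    rwa [he] at this
  have hsymm : ∀ w t, (w, t) ∈ e.target → e.symm (w, t) = ((e.symm (w, t)).1, t) := fun w t h =>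
    Prod.ext rfl (congrArg (fun q : Phase n × ℝ => q.2) (hright _ h) :)
  have hleft : ∀ p ∈ e.source, e.symm ((a p).2, p.2) = p := fun p hp => by
    have := e.left_inv hp
    rwa [he] at this
  set f : Phase n → ℝ → Phase n := fun w t => (a (e.symm (w, t))).1 with hf
  have hfC : ∀ w ∈ ball w₀ ρ, ∀ t, |t - t₀| < δ →
      ContDiffAt ℝ 1 (fun q : Phase n × ℝ => f q.1 q.2) (w, t) := fun w hw t ht =>
    (ContDiffAt.comp (g := a) (w, t) (haC _ (hP w hw t ht).2.2) (hP w hw t ht).1).fst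
  -- `N (C M + D) = A M + B`, by differentiating `w(h(x), t) = x` and `f(x, t) = ŵ(h(x), t)`,
  -- where `h` is the inverse of `z ↦ w` at time `t`
  have hJf : ∀ p ∈ G, p ∈ e.source → (a p).2 ∈ ball w₀ ρ → |p.2 - t₀| < δ →
      (jacobian (fun x => (a (x, p.2)).2) p.1).det ≠ 0 ∧
      jacobian (fun x => f x p.2) (a p).2 * jacobian (fun x => (a (x, p.2)).2) p.1 =
        jacobian (fun x => (a (x, p.2)).1) p.1 := by
    intro p hpG hps hpP hpt
    set w := (a p).2 with hw
    have hep : e.symm (w, p.2) = p := hleft p hps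
    set h : Phase n → Phase n := fun x => (e.symm (x, p.2)).1 with hh
    have hhw : h w = p.1 := by simp only [hh, hep]
    have hhd : DifferentiableAt ℝ h w :=
      (DifferentiableAt.comp (g := e.symm) (f := fun x => (x, p.2)) w
        ((hP w hpP p.2 hpt).1.differentiableAt (by simp)) (by fun_prop)).fst
    have hev : ∀ᶠ x in 𝓝 w, e.symm (x, p.2) = (h x, p.2) ∧ (a (h x, p.2)).2 = x := by
      filter_upwards [isOpen_ball.mem_nhds hpP] with x hx
      have h1 := (hP x hx p.2 hpt).2.1
      have h2 := hsymm x p.2 h1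
      refine ⟨h2, ?_⟩
      have h3 := congrArg Prod.fst (hright _ h1)
      rwa [h2] at h3
    have hd : DifferentiableAt ℝ (fun x => a (x, p.2)) (h w) := by
      rw [hhw]; exact hslice p hpG
    have e1 : jacobian (fun x => (a (x, p.2)).2) p.1 * jacobian h w = 1 := by
      rw [← hhw, ← jacobian_comp hd.snd hhd]
      exact jacobian_eq_one_of_eventuallyEq_id (hev.mono fun x hx => hx.2)
    have e2 : jacobian (fun x => f x p.2) w =
        jacobian (fun x => (a (x, p.2)).1) p.1 * jacobian h w := by
      rw [← hhw, ← jacobian_comp hd.fst hhd]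
      have : (fun x => f x p.2) =ᶠ[𝓝 w] fun x => (a (h x, p.2)).1 :=
        hev.mono fun x hx => by simp only [hf, hx.1]
      simp only [jacobian, this.fderiv_eq]
    refine ⟨fun h0 => ?_, ?_⟩
    · have := congrArg Matrix.det e1
      rw [det_mul, h0, zero_mul, det_one] at this
      exact zero_ne_one this
    · rw [e2, mul_assoc, mul_eq_one_comm.1 e1, mul_one]
  have hδpos : 0 < δ := lt_min hε hρ
  refine ⟨δ, ball z₀ ε, ball w₀ ρ, f, hδpos, isOpen_ball, mem_ball_self hε, isOpen_ball,
    convex_ball _ _, mem_ball_self hρ, fun q hq => (hfC q.1 hq.1 q.2 hq.2).contDiffWithinAt,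
    fun t ht w hw => ?_, fun t ht z hz => ?_⟩
  · obtain ⟨-, htar, hpG⟩ := hP w hw t ht
    set p := e.symm (w, t) with hp
    have hps : p ∈ e.source := e.map_target htar
    have hpt : p.2 = t := congrArg Prod.snd (hright _ htar)
    have hpw : (a p).2 = w := congrArg Prod.fst (hright _ htar)
    have hfp : f w t = (a p).1 := rfl
    have hap : (f w t, w) = a p := by rw [hfp, ← hpw]
    obtain ⟨hdet, hmul⟩ := hJf p hpG hps (by rwa [hpw]) (by rwa [hpt])
    have hbp := (hbox p.1 hpG.1).2 p.2 hpG.2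
    have hsrc := mem_source (α := α) (hreg p hpG).1 (hreg p hpG).2
    have hlag := transpose_mul_eq_transpose_mul_of_lagrangian
      (α.lagrangian p.2 t₀ _ hsrc) hbp.2.2.2
    rw [hpw, hpt] at hmul
    rw [hpt] at hdet
    have hJR' := hJR p hpG
    have hJS' := hJS p hpG
    rw [hpt] at hJR' hJS' hsrc hbp
    refine ⟨?_, ?_, ?_⟩
    · have hN : jacobian (fun x => f x t) w = jacobian (fun x => (a (x, t)).1) p.1 *
          (jacobian (fun x => (a (x, t)).2) p.1)⁻¹ := by
        rw [← hmul, mul_assoc, mul_nonsing_inv _ (isUnit_iff_ne_zero.2 hdet), mul_one]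
      rw [hN]
      refine isSymm_mul_nonsing_inv hdet ?_
      rw [hJR', hJS', ← hpt]
      exact hlag
    · rw [hap, ha]
      simp only [hpt]
      exact (α.toFun t t₀).map_source hsrc
    · have hcal : ∀ N, α.calA (f w t) w N t t₀ = α.calAbar (g p.1 t t₀) p.1 N t t₀ := by
        intro N
        have h1 : (α.toFun t t₀).symm (f w t, w) = (g p.1 t t₀, p.1) := by
          rw [hap, ha]
          simp only [hpt]
          exact (α.toFun t t₀).left_inv hsrc
        rw [calA, h1]
      obtain ⟨da, db, hda, hdb, hAbar⟩ := exists_hasDerivAt_along (α := α)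
        (γ := fun s => g p.1 s t₀) (by simpa only [hpt] using (hreg p hpG).1)
        (hreg p hpG).2 hbp.2.1
      have hF := ((hfC w hw t ht).differentiableAt (by simp)).hasFDerivAt
      set Df := fderiv ℝ (fun q : Phase n × ℝ => f q.1 q.2) (w, t) with hDf
      have hpz : ((α.snd (g p.1 t t₀) p.1 t t₀), t) = (w, t) := by
        rw [← hpw]
        simp only [ha, snd, hpt]
      -- differentiate `f (w(z,s), s) = ŵ(z,s)` along the flow
      have hcomp : HasDerivAt (fun s => f (α.snd (g p.1 s t₀) p.1 s t₀) s) (Df (db, 1)) t := by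
        refine HasFDerivAt.comp_hasDerivAt (l := fun q : Phase n × ℝ => f q.1 q.2)
          (f := fun s => (α.snd (g p.1 s t₀) p.1 s t₀, s)) t ?_ (hdb.prodMk (hasDerivAt_id t))
        rw [hpz]; exact hF
      have hev : (fun s => α.fst (g p.1 s t₀) p.1 s t₀) =ᶠ[𝓝 t]
          fun s => f (α.snd (g p.1 s t₀) p.1 s t₀) s := by
        have hs : ∀ᶠ s in 𝓝 t, (p.1, s) ∈ e.source :=
          (Continuous.prodMk_right p.1).continuousAt.preimage_mem_nhds
            (e.open_source.mem_nhds (by rw [← hpt]; exact hps))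
        filter_upwards [hs] with s hs
        have := hleft _ hs
        simp only [hf]
        change _ = (a (e.symm ((a (p.1, s)).2, s))).1
        rw [this]
        rfl
      have hDa : Df (db, 1) = da := (hcomp.congr_of_eventuallyEq hev).unique hda
      have hDw : jacobian (fun x => f x t) w *ᵥ db = Df (db, 0) := by
        rw [jacobian_mulVec]
        have h1 := (HasFDerivAt.comp (g := fun q : Phase n × ℝ => f q.1 q.2)
          (f := fun x => (x, t)) w hF (hasFDerivAt_prodMk_left w t)).fderiv
        exact congrArg (fun L => L db) h1
      have hDt : HasDerivAt (fun s => f w s) (Df (0, 1)) t :=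
        HasFDerivAt.comp_hasDerivAt (l := fun q : Phase n × ℝ => f q.1 q.2)
          (f := fun s => (w, s)) t hF ((hasDerivAt_const t w).prodMk (hasDerivAt_id t))
      have hval : Df (0, 1) = α.calA (f w t) w (jacobian (fun x => f x t) w) t t₀ := by
        rw [hcal, hAbar, hDw, ← hDa, ← map_sub]
        simp
      rwa [hval] at hDt
  · obtain ⟨hps, hpP, hpG⟩ := hU z hz t ht
    obtain ⟨hdet, hmul⟩ := hJf (z, t) hpG hps hpP ht
    rw [hJS _ hpG] at hdet hmul
    rw [hJR _ hpG] at hmul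
    have hb := (hbox z hpG.1).2 t hpG.2
    refine ⟨hb.1, hgz _ hpG, hb.2.1, (hreg _ hpG).2, hpP, ?_, hdet, hmul⟩
    simp only [hf]
    change _ = (a (e.symm ((a (z, t)).2, t))).1
    rw [hleft _ hps]
    rfl

end Birkhoff

end

theorem theorem4p1 {n : ℕ} (S : Birkhoff.System n) (α : Birkhoff.Transformation S)
    (W : Set (Birkhoff.Phase n × ℝ × ℝ)) (g : Birkhoff.Phase n → ℝ → ℝ → Birkhoff.Phase n)
    (hg : S.IsPhaseFlow W g) (z₀ : Birkhoff.Phase n) (t₀ : ℝ) (hz₀ : (z₀, t₀) ∈ S.region)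
    (hCD : (α.C z₀ z₀ t₀ t₀ + α.D z₀ z₀ t₀ t₀).det ≠ 0) :
    ∃ (δ : ℝ) (U P : Set (Birkhoff.Phase n))
      (f : Birkhoff.Phase n → ℝ → Birkhoff.Phase n) (φ : Birkhoff.Phase n → ℝ → ℝ),
      0 < δ ∧ IsOpen U ∧ z₀ ∈ U ∧ IsOpen P ∧ α.snd z₀ z₀ t₀ t₀ ∈ P ∧
      ContDiffOn ℝ 1 (fun q : Birkhoff.Phase n × ℝ => f q.1 q.2)
        (P ×ˢ {t : ℝ | |t - t₀| < δ}) ∧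
      (∀ t : ℝ, |t - t₀| < δ → ContDiffOn ℝ 2 (fun w => φ w t) P) ∧
      -- `f` is the gradient map of `φ`, its Jacobian is symmetric, and `φ_w` solves the
      -- Hamilton-Jacobi type equation
      (∀ t : ℝ, |t - t₀| < δ → ∀ w ∈ P,
        (Birkhoff.jacobian (fun x => f x t) w).IsSymm ∧
        f w t = Birkhoff.grad (fun x => φ x t) w ∧
        (Birkhoff.grad (fun x => φ x t) w, w) ∈ (α.toFun t t₀).target ∧
        HasDerivAt (fun s => Birkhoff.grad (fun x => φ x s) w)
          (α.calA (Birkhoff.grad (fun x => φ x t) w) w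
            (Birkhoff.jacobian (Birkhoff.grad (fun x => φ x t)) w) t t₀) t) ∧
      (∀ t : ℝ, |t - t₀| < δ → ∀ z ∈ U,
        (z, t, t₀) ∈ W ∧ DifferentiableAt ℝ (fun x => g x t t₀) z ∧
        -- `f` and `φ_w` generate the phase flow
        α.snd (g z t t₀) z t t₀ ∈ P ∧
        α.fst (g z t t₀) z t t₀ = f (α.snd (g z t t₀) z t t₀) t ∧
        α.fst (g z t t₀) z t t₀ =
          Birkhoff.grad (fun x => φ x t) (α.snd (g z t t₀) z t t₀) ∧
        -- `Ā = dŵ/dt - N dw/dt`, where `d/dt` is the derivative along the flow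
        (∃ a b : Birkhoff.Phase n,
          HasDerivAt (fun s => α.fst (g z s t₀) z s t₀) a t ∧
          HasDerivAt (fun s => α.snd (g z s t₀) z s t₀) b t ∧
          ∀ N : Matrix (Fin (2 * n)) (Fin (2 * n)) ℝ,
            α.calAbar (g z t t₀) z N t t₀ = a - N *ᵥ b) ∧
        -- the Jacobians `M` of the flow and `N` of `f` are fractional transforms of each other
        (∀ (what w : Birkhoff.Phase n) (M N : Matrix (Fin (2 * n)) (Fin (2 * n)) ℝ),
          what = α.fst (g z t t₀) z t t₀ → w = α.snd (g z t t₀) z t t₀ →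
          M = Birkhoff.jacobian (fun x => g x t t₀) z →
          N = Birkhoff.jacobian (fun x => f x t) w →
          (α.C (g z t t₀) z t t₀ * M + α.D (g z t t₀) z t t₀).det ≠ 0 ∧
          N = (α.A (g z t t₀) z t t₀ * M + α.B (g z t t₀) z t t₀) *
            (α.C (g z t t₀) z t t₀ * M + α.D (g z t t₀) z t t₀)⁻¹ ∧
          (α.invC what w t t₀ * N + α.invD what w t t₀).det ≠ 0 ∧
          M = (α.invA what w t t₀ * N + α.invB what w t t₀) *
            (α.invC what w t t₀ * N + α.invD what w t t₀)⁻¹)) := by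
  obtain ⟨δ, U, P, f, hδ, hU, hzU, hP, hPc, hwP, hfC, hHJ, hflow⟩ :=
    α.exists_generating_map hg hz₀ hCD
  have hex : ∀ t : ℝ, ∃ φ : Birkhoff.Phase n → ℝ, |t - t₀| < δ →
      ContDiffOn ℝ 2 φ P ∧ ∀ w ∈ P, Birkhoff.grad φ w = f w t := by
    intro t
    by_cases ht : |t - t₀| < δ
    · have hft : ContDiffOn ℝ 1 (fun w => f w t) P :=
        hfC.comp (f := fun w => (w, t)) (by fun_prop) fun w hw => ⟨hw, ht⟩
      obtain ⟨φ, hφ⟩ := Birkhoff.exists_grad_eq_of_isSymm_jacobian hP hPc hft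
        fun w hw => (hHJ t ht w hw).1
      exact ⟨φ, fun _ => hφ⟩
    · exact ⟨0, fun h => absurd h ht⟩
  choose φ hφ using hex
  have hgrad : ∀ t, |t - t₀| < δ → ∀ w ∈ P, Birkhoff.grad (φ t) w = f w t := fun t ht =>
    (hφ t ht).2
  refine ⟨δ, U, P, f, fun w t => φ t w, hδ, hU, hzU, hP, hwP, hfC, fun t ht => (hφ t ht).1,
    fun t ht w hw => ?_, fun t ht z hz => ?_⟩
  · obtain ⟨hs, htar, hder⟩ := hHJ t ht w hw
    have hjac : Birkhoff.jacobian (Birkhoff.grad (φ t)) w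
        = Birkhoff.jacobian (fun x => f x t) w := by
      have : Birkhoff.grad (φ t) =ᶠ[nhds w] fun x => f x t :=
        Filter.eventually_of_mem (hP.mem_nhds hw) (hgrad t ht)
      simp only [Birkhoff.jacobian, this.fderiv_eq]
    have htime : (fun s => Birkhoff.grad (φ s) w) =ᶠ[nhds t] fun s => f w s := by
      have ho : IsOpen {s : ℝ | |s - t₀| < δ} := isOpen_lt (by fun_prop) (by fun_prop)
      exact Filter.eventually_of_mem (ho.mem_nhds ht) fun s hs => hgrad s hs w hw
    refine ⟨hs, (hgrad t ht w hw).symm, ?_, ?_⟩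
    · rw [hgrad t ht w hw]; exact htar
    · rw [hgrad t ht w hw, hjac]
      exact hder.congr_of_eventuallyEq htime
  · obtain ⟨hW, hd, hder, hreg, hw, hfst, hdet, hmul⟩ := hflow t ht z hz
    have hreg' := hg.mem_region z t t₀ hW
    refine ⟨hW, hd, hw, hfst, ?_, ?_, ?_⟩
    · rw [hgrad t ht _ hw]; exact hfst
    · exact Birkhoff.Transformation.exists_hasDerivAt_along (γ := fun s => g z s t₀) hreg' hreg hder
    · rintro what w M N rfl rfl rfl rfl
      refine ⟨hdet, ?_, Birkhoff.Transformation.inverse_fractional_transform hreg' hreg hmul⟩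
      rw [← hmul, mul_assoc, Matrix.mul_nonsing_inv _ (isUnit_iff_ne_zero.2 hdet), mul_one]
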